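/- Let $n\ge 2$, $\mu\in\mathbb R$, and let $V=H_n(\mathbb C)$ be the Jordan algebra of complex hermitian $n\times n$ matrices with Jordan product $uv=\frac12(u\cdot v+v\cdot u)$, identity $e$, inner product $\langle u|v\rangle=\frac1n\operatorname{tr}(uv)$, commutator $[u,v]=u\cdot v-v\cdot u$, Jordan multiplications $L_u w=uw$, and $S_{uv}=[L_u,L_v]+L_{uv}$, $\{uvw\}=S_{uv}(w)$. Let $\mathcal C_1\subset V$ be the submanifold of positive semidefinite matrices of rank one, and identify $T^*\mathcal C_1$ with $T\mathcal C_1=\{(x,\pi): x\in\mathcal C_1,\ \pi\in T_x\mathcal C_1\}\subset V\times V$ by means of $\langle\,|\,\rangle$. Let $\omega_{\mathcal C_1}$ be the canonical symplectic form on $T^*\mathcal C_1$ (locally $dp_i\wedge dq^i$), let $\omega_K=-\mathrm i\,\operatorname{tr}(x\,dx\wedge dx)/(\operatorname{tr}x)^3$ be the Kepler form on $\mathcal C_1$ (where $(dx\wedge dx)(a,b)=[a,b]$), pulled back to $T\mathcal C_1$, and put $\omega_\mu=\omega_{\mathcal C_1}+2\mu\,\omega_K$. (0) $\omega_\mu$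 is nondegenerate: every smooth function $g$ on $T\mathcal C_1$ has, at each point, a unique Hamiltonian vector $\xi_g$, determined by $\omega_\mu(\xi_g,\cdot)=-dg$. Let $\{f,g\}=df(\xi_g)$ be the Poisson bracket of $\omega_\mu$ (so that $\{q^i,p_j\}=\delta^i_j$). For $u,v\in V$ define functions on $T\mathcal C_1$ by $$\mathcal X_u=\langle x|\{\pi u\pi\}\rangle+\frac{n\mu^2}{(\operatorname{tr}x)^2}\operatorname{tr}(xu)-\mu\,\mathrm i\,\frac{\operatorname{tr}(x[u,\pi])}{\operatorname{tr}x},\qquad \mathcal Y_v=\langle v|x\rangle,$$ $$\mathcal S_{uv}=\langle S_{uv}(x)|\pi\rangle-\mu\,\mathrm i\,\frac{\operatorname{tr}(x[u,v])}{2\operatorname{tr}x}.$$ (1) These functions are smooth, and for all $u,v,z,w\in V$ $$\{\mathcal X_u,\mathcal X_v\}=0,\quad \{\mathcal Y_u,\mathcal Y_v\}=0,\quad \{\mathcal X_u,\mathcal Y_v\}=-2\mathcal S_{uv},$$ $$\{\mathcal S_{uv},\mathcal X_z\}=\mathcal X_{\{uvz\}},\quad \{\mathcal S_{uv},\mathcal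 Y_z\}=-\mathcal Y_{\{vuz\}},\quad \{\mathcal S_{uv},\mathcal S_{zw}\}=\mathcal S_{\{uvz\}w}-\mathcal S_{z\{vuw\}},$$ which are the commutation relations of the conformal algebra $\mathfrak{co}(V)$. (2) There is a real-linear map $\Phi:\mathfrak{su}(n,n)\to C^\infty(T\mathcal C_1,\mathbb R)$ with $\Phi([A,B])=\{\Phi(A),\Phi(B)\}$ for all $A,B$, whose image is the real span of all $\mathcal X_u$, $\mathcal Y_v$, $\mathcal S_{uv}$. (3) The Hamiltonian of the $\mathrm U(1)$-Kepler problem, $H=\frac{\langle x|\pi^2\rangle}{2r}+\frac{n^2\mu^2}{2(\operatorname{tr}x)^2}-\frac{n}{\operatorname{tr}x}$ with $r=\langle e|x\rangle$, is smooth and equals $\frac12\frac{\mathcal X_e}{\mathcal Y_e}-\frac1{\mathcal Y_e}$. For every $u\in V$ the component $\mathcal A_u=\frac12\left(\mathcal X_u-\mathcal Y_u\frac{\mathcal X_e}{\mathcal Y_e}\right)+\frac{\mathcal Y_u}{\mathcal Y_e}$ of the Laplace–Runge–Lenz vector is smooth and conserved: $\{\mathcal A_u,H\}=0$. -/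

import Mathlib

open scoped ContDiff ComplexOrder Matrix

/- The norm only serves to supply the usual topology and smooth structure of the
finite-dimensional real vector space of complex matrices. -/
attribute [local instance] Matrix.frobeniusNormedRing Matrix.frobeniusNormedAlgebra

noncomputable section

namespace U1Kepler

/-- The topology of the norm (it is the entrywise one, as the next lemma says). -/
instance matrixTopology (n : ℕ) : TopologicalSpace (Matrix (Fin n) (Fin n) ℂ) :=
  PseudoMetricSpace.toUniformSpace.toTopologicalSpace

theorem matrixTopology_eq (n : ℕ) : matrixTopology n = instTopologicalSpaceMatrix := rfl

/-- Complex matrices of order `n`. The Jordan algebra `V = H_n(ℂ)` is the real subspace of those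
`u` with `u.IsHermitian`. -/
abbrev Mat (n : ℕ) : Type := Matrix (Fin n) (Fin n) ℂ

variable {n : ℕ}

/-! ### The Euclidean Jordan algebra of hermitian matrices -/

/-- The Jordan product `u v = (u·v + v·u)/2`. -/
def jordan (u v : Mat n) : Mat n := (1 / 2 : ℝ) • (u * v + v * u)

/-- The trace as a real number (the trace of a hermitian matrix is real). -/
def rtr (u : Mat n) : ℝ := u.trace.re

/-- The inner product `⟨u | v⟩ = (1/n) tr (u v)`, for which the identity matrix is a unit vector. -/
def ip (u v : Mat n) : ℝ := (1 / (n : ℝ)) * rtr (jordan u v)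

/-- `S_{uv} = [L_u, L_v] + L_{uv}`, where `L_u` is Jordan multiplication by `u`.
The triple product is `{u v w} = S_{uv}(w)`. -/
def str (u v w : Mat n) : Mat n :=
  jordan u (jordan v w) - jordan v (jordan u w) + jordan (jordan u v) w

/-! ### The cone of rank one elements and its tangent bundle -/

/-- The tangent space at `x` of an embedded submanifold `s` of a vector space, as a linear subspace
of the ambient space (the tangent cone of a submanifold is already a linear subspace; the span
just turns it into a `Submodule`). -/
def tangentAt {E : Type*} [NormedAddCommGroup E] [NormedSpace ℝ E] (s : Set E) (x : E) :
    Submodule ℝ E :=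
  Submodule.span ℝ (tangentConeAt ℝ s x)

/-- `C_1`, the positive semidefinite hermitian matrices of rank one. -/
def cone (n : ℕ) : Set (Mat n) := {x | x.PosSemidef ∧ x.rank = 1}

/-- `T C_1`, as the set of pairs `(x, π)` with `x ∈ C_1` and `π` tangent to `C_1` at `x`. -/
def tangentBundle (n : ℕ) : Set (Mat n × Mat n) :=
  {Q | Q.1 ∈ cone n ∧ Q.2 ∈ tangentAt (cone n) Q.1}

/-- `T C_1` as a type. By means of the inner product it is identified with `T^* C_1`: the pair
`(x, π)` stands for the covector `⟨π | · ⟩` at `x`. -/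
abbrev PhaseSpace (n : ℕ) : Type := tangentBundle n

/-- The tangent space of the phase space at a point. -/
def phaseTangent (Q : PhaseSpace n) : Submodule ℝ (Mat n × Mat n) :=
  tangentAt (tangentBundle n) Q

/-- Extension by zero of a function on the phase space to the ambient space; only its values on
`T C_1` matter below. -/
def ext (f : PhaseSpace n → ℝ) : Mat n × Mat n → ℝ := Function.extend Subtype.val f 0

/-- Smooth functions on the submanifold `T C_1`. -/
def IsSmooth (f : PhaseSpace n → ℝ) : Prop := ContDiffOn ℝ ∞ (ext f) (tangentBundle n)

/-- The differential of `f` at `Q`; it is only ever evaluated on vectors of `phaseTangent Q`,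
on which it is determined by `f`. -/
def diff (f : PhaseSpace n → ℝ) (Q : PhaseSpace n) : (Mat n × Mat n) →L[ℝ] ℝ :=
  fderivWithin ℝ (ext f) (tangentBundle n) Q

/-! ### The symplectic form and the Poisson bracket -/

/-- The linear form `(ẋ, π̇) ↦ ⟨π | ẋ⟩`, with its linear dependence on `π`. -/
def pairing (n : ℕ) : Mat n →ₗ[ℝ] (Mat n × Mat n) →ₗ[ℝ] ℝ :=
  LinearMap.mk₂ ℝ (fun π ξ => ip π ξ.1)
    (by intro a b c; simp only [ip, jordan, rtr, add_mul, mul_add, smul_add, Matrix.trace_add,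
          Complex.add_re]; ring)
    (by intro c a b; simp only [ip, jordan, rtr, smul_mul_assoc, mul_smul_comm, ← smul_add,
          Matrix.trace_smul, Complex.real_smul, Complex.re_ofReal_mul, smul_eq_mul]; ring)
    (by intro a b c; simp only [ip, jordan, rtr, Prod.fst_add, add_mul, mul_add, smul_add,
          Matrix.trace_add, Complex.add_re]; ring)
    (by intro c a b; simp only [ip, jordan, rtr, Prod.smul_fst, smul_mul_assoc, mul_smul_comm,
          ← smul_add, Matrix.trace_smul, Complex.real_smul, Complex.re_ofReal_mul,
          smul_eq_mul]; ring)

theorem pairing_apply (π : Mat n) (ξ : Mat n × Mat n) : pairing n π ξ = ip π ξ.1 := rfl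

/-- The tautological one-form `θ` on `V × V = T V`: at `Q = (x, π)` it sends a tangent vector
`(ẋ, π̇)` to `⟨π | ẋ⟩`. Its restriction to `T C_1` is the tautological one-form of `T^* C_1`. -/
def tautological (Q : Mat n × Mat n) : (Mat n × Mat n) [⋀^Fin 1]→L[ℝ] ℝ :=
  ContinuousAlternatingMap.ofSubsingleton ℝ (Mat n × Mat n) ℝ 0
    (LinearMap.toContinuousLinearMap (pairing n Q.2))

/-- The canonical symplectic form `dθ` (in local coordinates `dp_i ∧ dq^i`). -/
def canonicalForm (Q ξ η : Mat n × Mat n) : ℝ := extDeriv tautological Q ![ξ, η]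

/-- The Kepler form `-i tr (x dx ∧ dx) / (tr x)^3` on `C_1`, where
`(dx ∧ dx)(a, b) = a·b - b·a`. It is real on hermitian matrices. -/
def keplerForm (x a b : Mat n) : ℝ :=
  (-Complex.I * (x * ⁅a, b⁆).trace / x.trace ^ 3).re

/-- The twisted form `ω_μ`, the sum of the canonical form and `2 μ` times the pullback of the
Kepler form under `(x, π) ↦ x`. -/
def twistedForm (μ : ℝ) (Q ξ η : Mat n × Mat n) : ℝ :=
  canonicalForm Q ξ η + 2 * μ * keplerForm Q.1 ξ.1 η.1

/-- `ξ` is the Hamiltonian vector of `g` at `Q`: it is tangent to the phase space and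
`ω_μ(ξ, ·) = -dg` there. -/
def IsHamiltonianVector (μ : ℝ) (g : PhaseSpace n → ℝ) (Q : PhaseSpace n)
    (ξ : Mat n × Mat n) : Prop :=
  ξ ∈ phaseTangent Q ∧ ∀ η ∈ phaseTangent Q, twistedForm μ Q ξ η = -diff g Q η

open Classical in
/-- The Hamiltonian vector field of `g` with respect to `ω_μ`. -/
def hamiltonianVector (μ : ℝ) (g : PhaseSpace n → ℝ) (Q : PhaseSpace n) : Mat n × Mat n :=
  if h : ∃ ξ, IsHamiltonianVector μ g Q ξ then h.choose else 0

/-- The Poisson bracket `{f, g}_μ`, the derivative of `f` along the Hamiltonian vector field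
of `g`; the sign is such that `{q^i, p_j} = δ^i_j`. -/
def poisson (μ : ℝ) (f g : PhaseSpace n → ℝ) : PhaseSpace n → ℝ :=
  fun Q => diff f Q (hamiltonianVector μ g Q)

/-! ### The functions on the phase space -/

/-- `X_u = ⟨x | {π u π}⟩ + n μ² tr (x u) / (tr x)² - μ i tr (x [u, π]) / tr x`.
The number `i tr (x [u, π])` is real. -/
def fX (μ : ℝ) (u : Mat n) : PhaseSpace n → ℝ := fun Q =>
  ip Q.1.1 (str Q.1.2 u Q.1.2) + n * μ ^ 2 / rtr Q.1.1 ^ 2 * rtr (jordan Q.1.1 u)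
    - μ * (Complex.I * (Q.1.1 * ⁅u, Q.1.2⁆).trace).re / rtr Q.1.1

/-- `Y_v = ⟨v | x⟩`. -/
def fY (v : Mat n) : PhaseSpace n → ℝ := fun Q => ip v Q.1.1

/-- `S_{uv} = ⟨S_{uv}(x) | π⟩ - μ i tr (x [u, v]) / (2 tr x)`. -/
def fS (μ : ℝ) (u v : Mat n) : PhaseSpace n → ℝ := fun Q =>
  ip (str u v Q.1.1) Q.1.2
    - μ * (Complex.I * (Q.1.1 * ⁅u, v⁆).trace).re / (2 * rtr Q.1.1)

/-- The Hamiltonian of the `U(1)`-Kepler problem of level `n` and magnetic charge `μ`: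
`⟨x | π²⟩ / (2 r) + n² μ² / (2 (tr x)²) - n / tr x` with `r = ⟨e | x⟩ = tr x / n`. -/
def hamiltonian (μ : ℝ) : PhaseSpace n → ℝ := fun Q =>
  ip Q.1.1 (jordan Q.1.2 Q.1.2) / (2 * ip 1 Q.1.1)
    + n ^ 2 * μ ^ 2 / (2 * rtr Q.1.1 ^ 2) - n / rtr Q.1.1

/-- The component along `u` of the Laplace–Runge–Lenz vector,
`A_u = (X_u - Y_u X_e / Y_e) / 2 + Y_u / Y_e`. -/
def lrl (μ : ℝ) (u : Mat n) : PhaseSpace n → ℝ :=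
  (1 / 2 : ℝ) • (fX μ u - fY u * (fX μ 1 / fY 1)) + fY u / fY 1

/-! ### The Lie algebra `su(n, n)` -/

attribute [local instance] LieRing.ofAssociativeRing

/-- The hermitian form of signature `(n, n)`. -/
def formJ (n : ℕ) : Matrix (Fin n ⊕ Fin n) (Fin n ⊕ Fin n) ℂ := Matrix.fromBlocks 1 0 0 (-1)

/-- The real Lie algebra `su(n, n)`, with the commutator of matrices as Lie bracket. -/
def su (n : ℕ) : LieSubalgebra ℝ (Matrix (Fin n ⊕ Fin n) (Fin n ⊕ Fin n) ℂ) where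
  carrier := {A | Aᴴ * formJ n + formJ n * A = 0 ∧ A.trace = 0}
  add_mem' := by
    rintro A B ⟨hA, hA'⟩ ⟨hB, hB'⟩
    refine ⟨?_, by rw [Matrix.trace_add, hA', hB', add_zero]⟩
    rw [Matrix.conjTranspose_add, add_mul, mul_add, add_add_add_comm, hA, hB, add_zero]
  zero_mem' := by simp
  smul_mem' := by
    rintro c A ⟨hA, hA'⟩
    refine ⟨?_, by rw [Matrix.trace_smul, hA', smul_zero]⟩
    rw [Matrix.conjTranspose_smul, star_trivial, smul_mul_assoc, mul_smul_comm, ← smul_add, hA,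
      smul_zero]
  lie_mem' := by
    rintro A B ⟨hA, -⟩ ⟨hB, -⟩
    refine ⟨?_, by rw [Ring.lie_def, Matrix.trace_sub, Matrix.trace_mul_comm, sub_self]⟩
    have h1 : Aᴴ * formJ n = -(formJ n * A) := eq_neg_of_add_eq_zero_left hA
    have h2 : Bᴴ * formJ n = -(formJ n * B) := eq_neg_of_add_eq_zero_left hB
    rw [Ring.lie_def, Matrix.conjTranspose_sub, Matrix.conjTranspose_mul,
      Matrix.conjTranspose_mul, sub_mul, mul_assoc, mul_assoc, h1, h2, mul_neg, mul_neg,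
      ← mul_assoc, ← mul_assoc, h1, h2]
    noncomm_ring

/-! ### Explicit form of the canonical form -/

theorem tautological_apply (Q : Mat n × Mat n) (v : Fin 1 → Mat n × Mat n) :
    tautological Q v = ip Q.2 (v 0).1 := rfl

theorem canonicalForm_apply (Q ξ η : Mat n × Mat n) :
    canonicalForm Q ξ η = ip ξ.2 η.1 - ip η.2 ξ.1 := by
  let T : (Mat n × Mat n) →ₗ[ℝ] (Mat n × Mat n) [⋀^Fin 1]→L[ℝ] ℝ :=
    { toFun := tautological
      map_add' := by
        intro a b
        ext v
        exact congrArg (fun l => l (v 0)) ((pairing n).map_add a.2 b.2)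
      map_smul' := by
        intro c a
        ext v
        exact congrArg (fun l => l (v 0)) ((pairing n).map_smul c a.2) }
  have hT : fderiv ℝ (tautological (n := n)) Q = LinearMap.toContinuousLinearMap T :=
    (LinearMap.toContinuousLinearMap T).hasFDerivAt.fderiv
  unfold canonicalForm extDeriv
  rw [hT, ContinuousAlternatingMap.alternatizeUncurryFin_apply, Fin.sum_univ_two]
  change (-1 : ℤ) ^ 0 • ip ξ.2 η.1 + (-1 : ℤ) ^ 1 • ip η.2 ξ.1 = _
  simp [sub_eq_add_neg]

end U1Kepler

end

/-! The twisted phase space is a symplectic quotient of a linear space. Every point of `cone n` is z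
z† with z ≠ 0 unique up to a phase, and a tangent vector π there has the form ζ z† + z ζ†. Put w = π
z + i n μ z / (z† z). Then ⟨π | dx⟩ = (2/n) Re ((π z)† dz), while the extra term of w contributes 2
μ Im (z† dz) / (z† z), a primitive of the pullback of 2 μ times the Kepler form. So `twistedForm`
pulls back to the constant form (2/n) Re (ψ'† K φ') in ψ = (z, w), restricted to the level Im (z† w)
= n μ (`twistedForm_bundleVec`).

In these coordinates the observables are quadratic, (1/n) Re (ψ† K M ψ). If M preserves K, its
linear flow preserves ψ† K ψ = -2 i Im (z† w), hence the level, and ψ' = M ψ is the Hamiltonian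
vector (`exists_isHamiltonianVector_obs`). Poisson brackets therefore become matrix commutators
(`poisson_obs`). The functions X, Y, S are the observables of the upper right, lower left and
diagonal blocks (`fX_eq_obs`, `fY_eq_obs`, `fS_eq_obs`), and the conformal relations are products of
2 × 2 block matrices.

A Cayley transform carries K to a multiple of the standard form of signature (n, n), so the matrices
preserving K with trace zero form a copy of su(n, n); the diagonal blocks that occur are spanned by
products of hermitian matrices (`range_realization`).

Conservation of the Laplace–Runge–Lenz vector is then formal: A_u = X_u / 2 - Y_u H with H Y_e = X_e
/ 2 - 1, and Leibniz and the brackets of X and Y suffice.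

All tangent spaces are computed by hand: polynomial equations bound them from above, the curves
obtained by moving z and ζ linearly fill them. -/

noncomputable section

namespace U1Kepler

attribute [local instance] LieRing.ofAssociativeRing

variable {n : ℕ}

/-! ### Hermitian products and rank one matrices -/

section Outer

variable {m : Type*}

/-- The rank one matrix `a b†`. -/
def outer (a b : m → ℂ) : Matrix m m ℂ := Matrix.vecMulVec a (star b)

theorem outer_add_left (a b c : m → ℂ) : outer (a + b) c = outer a c + outer b c := by
  simp [outer, Matrix.add_vecMulVec]

theorem outer_add_right (a b c : m → ℂ) : outer a (b + c) = outer a b + outer a c := by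
  simp [outer, Matrix.vecMulVec_add]

theorem outer_sub_left (a b c : m → ℂ) : outer (a - b) c = outer a c - outer b c := by
  simp [outer, Matrix.sub_vecMulVec]

theorem outer_sub_right (a b c : m → ℂ) : outer a (b - c) = outer a b - outer a c := by
  simp [outer, Matrix.vecMulVec_sub]

theorem outer_smul_left (c : ℂ) (a b : m → ℂ) : outer (c • a) b = c • outer a b := by
  simp [outer, Matrix.smul_vecMulVec]

theorem outer_smul_right (c : ℂ) (a b : m → ℂ) : outer a (c • b) = star c • outer a b := by
  simp [outer, Matrix.vecMulVec_smul]

theorem conjTranspose_outer (a b : m → ℂ) : (outer a b)ᴴ = outer b a := by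
  simp [outer, Matrix.conjTranspose_vecMulVec]

variable [Fintype m]

/-- The standard hermitian product, antilinear in the first argument. -/
def hip (a b : m → ℂ) : ℂ := star a ⬝ᵥ b

theorem hip_add_left (a b c : m → ℂ) : hip (a + b) c = hip a c + hip b c := by
  simp [hip, add_dotProduct]

theorem hip_add_right (a b c : m → ℂ) : hip a (b + c) = hip a b + hip a c := by
  simp [hip, dotProduct_add]

theorem hip_neg_right (a b : m → ℂ) : hip a (-b) = -hip a b := by simp [hip]

theorem hip_sub_left (a b c : m → ℂ) : hip (a - b) c = hip a c - hip b c := by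
  simp [hip, sub_dotProduct]

theorem hip_sub_right (a b c : m → ℂ) : hip a (b - c) = hip a b - hip a c := by
  simp [hip, dotProduct_sub]

theorem hip_smul_left (c : ℂ) (a b : m → ℂ) : hip (c • a) b = star c * hip a b := by
  simp [hip, smul_dotProduct]

theorem hip_smul_right (c : ℂ) (a b : m → ℂ) : hip a (c • b) = c * hip a b := by
  simp [hip, dotProduct_smul]

theorem star_hip (a b : m → ℂ) : star (hip a b) = hip b a :=
  (Matrix.star_dotProduct b a).symm

theorem hip_mulVec_right (M : Matrix m m ℂ) (a b : m → ℂ) :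
    hip a (M *ᵥ b) = hip (Mᴴ *ᵥ a) b := by
  simp [hip, Matrix.star_mulVec, Matrix.dotProduct_mulVec]

theorem hip_mulVec_left (M : Matrix m m ℂ) (a b : m → ℂ) :
    hip (M *ᵥ a) b = hip a (Mᴴ *ᵥ b) := by
  rw [hip_mulVec_right, Matrix.conjTranspose_conjTranspose]

theorem hip_self_ne_zero {a : m → ℂ} (ha : a ≠ 0) : hip a a ≠ 0 := by
  simpa [hip] using ha

theorem mul_outer (M : Matrix m m ℂ) (a b : m → ℂ) : M * outer a b = outer (M *ᵥ a) b :=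
  Matrix.mul_vecMulVec _ _ _

theorem outer_mul (M : Matrix m m ℂ) (a b : m → ℂ) : outer a b * M = outer a (Mᴴ *ᵥ b) := by
  simp [outer, Matrix.vecMulVec_mul, Matrix.star_mulVec]

theorem outer_mulVec (a b c : m → ℂ) : outer a b *ᵥ c = hip b c • a := by
  ext i
  simp [outer, hip, Matrix.vecMulVec_mulVec, mul_comm]

theorem trace_outer (a b : m → ℂ) : (outer a b).trace = hip b a := by
  simp [outer, hip, dotProduct_comm]

end Outer

/-! ### The cone of rank one elements -/

theorem outer_self_mem_cone {z : Fin n → ℂ} (hz : z ≠ 0) : outer z z ∈ cone n := by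
  refine ⟨Matrix.posSemidef_vecMulVec_self_star z, le_antisymm (Matrix.rank_vecMulVec_le _ _) ?_⟩
  rw [Nat.one_le_iff_ne_zero, Matrix.rank, ne_eq, Submodule.finrank_eq_zero,
    LinearMap.range_eq_bot]
  intro h
  have h1 := LinearMap.congr_fun h z
  rw [Matrix.mulVecLin_apply, outer_mulVec] at h1
  simp [hz, hip_self_ne_zero hz] at h1

/-- All columns are multiples of one vector p, hermiticity forces x = l p p†, and positivity makes l
a nonnegative real, whose square root is absorbed into p. -/
theorem exists_outer_of_mem_cone {x : Mat n} (hx : x ∈ cone n) :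
    ∃ z : Fin n → ℂ, z ≠ 0 ∧ x = outer z z := by
  obtain ⟨hpos, hrank⟩ := hx
  obtain ⟨v, hv0, hv⟩ := finrank_eq_one_iff'.1 hrank
  have hcol : ∀ j, ∃ c : ℂ, ∀ i, x i j = c * v.1 i := by
    intro j
    obtain ⟨c, hc⟩ := hv ⟨x *ᵥ Pi.single j 1, ⟨Pi.single j 1, rfl⟩⟩
    refine ⟨c, fun i => ?_⟩
    have := congrFun (congrArg Subtype.val hc) i
    simpa using this.symm
  choose c hc using hcol
  have hv1 : v.1 ≠ 0 := fun h => hv0 (Subtype.ext h)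
  generalize v.1 = p at hv1 hc
  clear hv0 hv v
  obtain ⟨j, hj⟩ := Function.ne_iff.1 hv1
  simp only [Pi.zero_apply, ne_eq] at hj
  -- Hermiticity of the entries (j, k), with p j ≠ 0, expresses every c k through c j.
  have hx1 : x = (star (c j) / p j) • outer p p := by
    ext i k
    have h := congrFun (congrFun hpos.1 j) k
    rw [Matrix.conjTranspose_apply, hc, hc, star_mul'] at h
    rw [hc, Matrix.smul_apply, outer, Matrix.vecMulVec_apply, Pi.star_apply, smul_eq_mul]
    field_simp
    linear_combination -p i * h
  set l := star (c j) / p j with hl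
  -- The quadratic form of x at p equals l (p† p)², with p† p > 0.
  have hl0 : 0 ≤ l := by
    have h1 := hpos.dotProduct_mulVec_nonneg p
    rw [hx1, Matrix.smul_mulVec, outer_mulVec] at h1
    change 0 ≤ hip _ _ at h1
    rw [hip_smul_right, hip_smul_right] at h1
    have h2 : 0 < hip p p * hip p p := by
      have : 0 < hip p p := Matrix.dotProduct_star_self_pos_iff.2 hv1
      positivity
    have h3 : 0 ≤ hip p p * hip p p * l := by
      convert h1 using 1
      ring
    generalize hip p p * hip p p = T at h2 h3
    rw [Complex.lt_def] at h2
    rw [Complex.le_def] at h3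
    simp only [Complex.zero_re, Complex.zero_im, Complex.mul_re, Complex.mul_im, ← h2.2, zero_mul,
      sub_zero, add_zero] at h2 h3
    rw [Complex.le_def]
    exact ⟨nonneg_of_mul_nonneg_right h3.1 h2.1,
      ((mul_eq_zero.1 h3.2.symm).resolve_left h2.1.ne').symm⟩
  have hl1 : l = ((Real.sqrt l.re : ℝ) : ℂ) * (Real.sqrt l.re : ℝ) := by
    rw [← Complex.ofReal_mul, Real.mul_self_sqrt (Complex.le_def.1 hl0).1]
    exact Complex.eq_re_of_ofReal_le hl0
  have hx2 : x = outer (((Real.sqrt l.re : ℝ) : ℂ) • p) (((Real.sqrt l.re : ℝ) : ℂ) • p) := by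
    rw [outer_smul_left, outer_smul_right, smul_smul, hx1]
    simp only [Complex.star_def, Complex.conj_ofReal]
    rw [← hl1]
  refine ⟨_, ?_, hx2⟩
  intro h
  rw [h] at hx2
  have hx3 : x = 0 := by simpa [outer] using hx2
  rw [hx3, Matrix.rank_zero] at hrank
  exact zero_ne_one hrank

/-! ### Tangent vectors of subsets of normed spaces -/

section Tangent

variable {E F : Type*} [NormedAddCommGroup E] [NormedSpace ℝ E] [NormedAddCommGroup F]
  [NormedSpace ℝ F] {s : Set E} {x : E}

/-- Derivatives within a set are determined on its tangent cone, hence on the span. This makes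
`diff` meaningful on tangent vectors although a submanifold does not determine a derivative in
transversal directions. -/
theorem eqOn_tangentAt {G : E → F} {A B : E →L[ℝ] F} (hA : HasFDerivWithinAt G A s x)
    (hB : HasFDerivWithinAt G B s x) {ξ : E} (hξ : ξ ∈ tangentAt s x) : A ξ = B ξ := by
  have : tangentAt s x ≤ LinearMap.eqLocus (A : E →ₗ[ℝ] F) (B : E →ₗ[ℝ] F) :=
    Submodule.span_le.2 fun y hy => HasFDerivWithinAt.unique_on hA hB hy
  exact this hξ

/-- The derivative of a function along a tangent vector of a set on which the function vanishes
is zero. -/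
theorem deriv_eq_zero_of_mem_tangentAt {G : E → F} (hG : DifferentiableAt ℝ G x)
    (hs : ∀ y ∈ s, G y = 0) (hx : x ∈ s) {ξ : E} (hξ : ξ ∈ tangentAt s x) {d : F}
    (hd : HasDerivAt (fun r : ℝ => G (x + r • ξ)) d 0) : d = 0 := by
  have h1 : HasFDerivWithinAt G (0 : E →L[ℝ] F) s x :=
    (hasFDerivWithinAt_const (0 : F) x s).congr hs (hs x hx)
  have h2 := eqOn_tangentAt hG.hasFDerivAt.hasFDerivWithinAt h1 hξ
  have h3 : HasDerivAt (fun r : ℝ => G (x + r • ξ)) (fderiv ℝ G x ξ) 0 :=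
    hG.hasFDerivAt.hasLineDerivAt ξ
  rw [hd.unique h3, h2]
  rfl

/-- Dividing the displacement by r leaves ξ + r η, which tends to ξ. Second order curves suffice
because the parametrizations below are quadratic in (z, ζ). -/
theorem mem_tangentAt_of_quadratic {ξ η : E}
    (h : ∀ᶠ r : ℝ in nhds 0, x + (r • ξ + r ^ 2 • η) ∈ s) : ξ ∈ tangentAt s x := by
  refine Submodule.subset_span (mem_tangentConeAt_of_seq (nhdsWithin (0 : ℝ) {0}ᶜ)
    (fun r => r⁻¹) (fun r => r • ξ + r ^ 2 • η) ?_ (h.filter_mono nhdsWithin_le_nhds) ?_)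
  · have : Continuous fun r : ℝ => r • ξ + r ^ 2 • η := by fun_prop
    simpa using this.tendsto' 0 0 (by simp) |>.mono_left nhdsWithin_le_nhds
  · have h1 : Filter.Tendsto (fun r : ℝ => ξ + r • η) (nhdsWithin (0 : ℝ) {0}ᶜ) (nhds ξ) := by
      have : Continuous fun r : ℝ => ξ + r • η := by fun_prop
      exact (this.tendsto' 0 ξ (by simp)).mono_left nhdsWithin_le_nhds
    refine h1.congr' ?_
    filter_upwards [self_mem_nhdsWithin] with r hr
    have hr : r ≠ 0 := hr
    rw [smul_add, smul_smul, smul_smul, inv_mul_cancel₀ hr, one_smul]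
    congr 2
    field_simp

end Tangent

/-! ### Calculus along lines in the space of matrices -/

theorem eventually_add_smul_ne_zero {z : Fin n → ℂ} (hz : z ≠ 0) (z' : Fin n → ℂ) :
    ∀ᶠ r : ℝ in nhds 0, z + (r : ℂ) • z' ≠ 0 := by
  have : Continuous fun r : ℝ => z + (r : ℂ) • z' := by fun_prop
  exact this.continuousAt.eventually_ne (by simpa using hz)

/-- The trace as a real continuous linear map. -/
def traceL (n : ℕ) : Mat n →L[ℝ] ℂ :=
  LinearMap.toContinuousLinearMap (Matrix.traceLinearMap (Fin n) ℝ ℂ)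

theorem hasDerivAt_line {E : Type*} [NormedAddCommGroup E] [NormedSpace ℝ E] (x a : E) :
    HasDerivAt (fun r : ℝ => x + r • a) a 0 := by
  simpa using ((hasDerivAt_id (0 : ℝ)).smul_const a).const_add x

theorem hasDerivAt_trace {f : ℝ → Mat n} {f' : Mat n} {r : ℝ} (h : HasDerivAt f f' r) :
    HasDerivAt (fun s => (f s).trace) f'.trace r :=
  (traceL n).hasFDerivAt.comp_hasDerivAt r h

theorem differentiable_trace : Differentiable ℝ (fun x : Mat n => x.trace) :=
  (traceL n).differentiable

theorem differentiable_conjTranspose : Differentiable ℝ (fun x : Mat n => xᴴ) :=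
  (LinearMap.toContinuousLinearMap
    (Matrix.conjTransposeLinearEquiv (Fin n) (Fin n) ℝ ℂ).toLinearMap).differentiable

theorem hasDerivAt_conjTranspose {f : ℝ → Mat n} {f' : Mat n} {r : ℝ} (h : HasDerivAt f f' r) :
    HasDerivAt (fun s => (f s)ᴴ) f'ᴴ r :=
  (LinearMap.toContinuousLinearMap
    (Matrix.conjTransposeLinearEquiv (Fin n) (Fin n) ℝ ℂ).toLinearMap).hasFDerivAt.comp_hasDerivAt
      r h

/-! ### The tangent spaces of the cone and of its tangent bundle -/

theorem outer_self_mul_self (z : Fin n → ℂ) :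
    outer z z * outer z z = (outer z z).trace • outer z z := by
  rw [mul_outer, outer_mulVec, outer_smul_left, trace_outer]

/-- The symmetric matrix `ζ z† + z ζ†`, tangent to the cone at `z z†`. -/
def symOuter (z ζ : Fin n → ℂ) : Mat n := outer ζ z + outer z ζ

theorem conjTranspose_symOuter (z ζ : Fin n → ℂ) : (symOuter z ζ)ᴴ = symOuter z ζ := by
  rw [symOuter, Matrix.conjTranspose_add, conjTranspose_outer, conjTranspose_outer, add_comm]

theorem symOuter_mulVec (z ζ a : Fin n → ℂ) :
    symOuter z ζ *ᵥ a = hip z a • ζ + hip ζ a • z := by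
  rw [symOuter, Matrix.add_mulVec, outer_mulVec, outer_mulVec]

theorem trace_symOuter (z ζ : Fin n → ℂ) : (symOuter z ζ).trace = hip z ζ + hip ζ z := by
  rw [symOuter, Matrix.trace_add, trace_outer, trace_outer]

theorem trace_im_eq_zero {k : Mat n} (hk : kᴴ = k) : star k.trace = k.trace := by
  rw [← Matrix.trace_conjTranspose, hk]

/-- The hypothesis `h` is the linearization of x² = (tr x) x at x = z z†. Together with hermiticity
it already cuts out the tangent space. -/
theorem exists_eq_symOuter {z : Fin n → ℂ} (hz : z ≠ 0) {k : Mat n} (hk : kᴴ = k)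
    (h : outer z z * k + k * outer z z = k.trace • outer z z + (outer z z).trace • k) :
    ∃ ζ, k = symOuter z ζ := by
  have ht := hip_self_ne_zero hz
  -- Solving `h` for k gives (z† z) k = z (k z)† + (k z) z† - (tr k) z z†; the last term is split
  -- evenly between the two others.
  refine ⟨(hip z z)⁻¹ • (k *ᵥ z - (k.trace / 2) • z), ?_⟩
  rw [trace_outer, mul_outer, outer_mul, hk] at h
  have h1 : k = (hip z z)⁻¹ • (hip z z • k) := by rw [smul_smul, inv_mul_cancel₀ ht, one_smul]
  rw [← sub_eq_iff_eq_add'.2 h] at h1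
  have h2 : star ((hip z z)⁻¹) = (hip z z)⁻¹ := by rw [star_inv₀, star_hip]
  have h3 : star (k.trace / 2) = k.trace / 2 := by
    rw [star_div₀, trace_im_eq_zero hk]; simp
  conv_lhs => rw [h1]
  rw [symOuter, outer_smul_left, outer_smul_right, outer_sub_left, outer_sub_right,
    outer_smul_left, outer_smul_right, h2, h3]
  module

/-- Upper bound: differentiate x† = x and x² = (tr x) x. Lower bound: the curve (z + r ζ)(z + r ζ)†
stays in the cone for small r. -/
theorem mem_tangentAt_cone_iff {z : Fin n → ℂ} (hz : z ≠ 0) {k : Mat n} :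
    k ∈ tangentAt (cone n) (outer z z) ↔ ∃ ζ, k = symOuter z ζ := by
  constructor
  · intro hk
    refine exists_eq_symOuter hz ?_ ?_
    · have h := deriv_eq_zero_of_mem_tangentAt (G := fun x : Mat n => xᴴ - x)
        (differentiable_conjTranspose.sub differentiable_id).differentiableAt
        (fun y hy => sub_eq_zero.2 hy.1.1) (outer_self_mem_cone hz) hk
        ((hasDerivAt_conjTranspose (hasDerivAt_line _ k)).sub (hasDerivAt_line _ k))
      exact sub_eq_zero.1 h
    · have hx := hasDerivAt_line (outer z z) k
      have h := deriv_eq_zero_of_mem_tangentAt (G := fun x : Mat n => x * x - x.trace • x)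
        ((differentiable_id.mul differentiable_id).sub
          (differentiable_trace.smul differentiable_id)).differentiableAt
        (fun y hy => by
          obtain ⟨w, -, rfl⟩ := exists_outer_of_mem_cone hy
          rw [outer_self_mul_self, sub_self]) (outer_self_mem_cone hz) hk
        ((hx.mul hx).sub ((hasDerivAt_trace hx).smul hx))
      simp only [zero_smul, add_zero] at h
      rw [add_comm, add_comm (k.trace • _)]
      exact sub_eq_zero.1 h
  · rintro ⟨ζ, rfl⟩
    refine mem_tangentAt_of_quadratic (η := outer ζ ζ) ?_
    filter_upwards [eventually_add_smul_ne_zero hz ζ] with r hr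
    convert outer_self_mem_cone hr using 1
    simp only [symOuter, outer_add_left, outer_add_right, outer_smul_left, outer_smul_right,
      Complex.star_def, Complex.conj_ofReal, ← Complex.coe_smul]
    module

/-- The parametrization `(z, ζ) ↦ (z z†, ζ z† + z ζ†)` of the phase space. -/
def bundlePoint (z ζ : Fin n → ℂ) : Mat n × Mat n := (outer z z, symOuter z ζ)

/-- The derivative of `bundlePoint` at `(z, ζ)` in the direction `(z', ζ')`. -/
def bundleVec (z ζ z' ζ' : Fin n → ℂ) : Mat n × Mat n :=
  (symOuter z z', symOuter z ζ' + symOuter ζ z')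

theorem mem_tangentBundle_iff {Q : Mat n × Mat n} :
    Q ∈ tangentBundle n ↔ ∃ z ζ, z ≠ 0 ∧ Q = bundlePoint z ζ := by
  constructor
  · rintro ⟨h1, h2⟩
    obtain ⟨z, hz, hx⟩ := exists_outer_of_mem_cone h1
    rw [hx, mem_tangentAt_cone_iff hz] at h2
    obtain ⟨ζ, hζ⟩ := h2
    exact ⟨z, ζ, hz, Prod.ext hx hζ⟩
  · rintro ⟨z, ζ, hz, rfl⟩
    exact ⟨outer_self_mem_cone hz, (mem_tangentAt_cone_iff hz).2 ⟨ζ, rfl⟩⟩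

theorem symOuter_tangent_identity (z ζ : Fin n → ℂ) :
    outer z z * symOuter z ζ + symOuter z ζ * outer z z
      = (symOuter z ζ).trace • outer z z + (outer z z).trace • symOuter z ζ := by
  simp only [Matrix.trace_add, trace_outer, mul_outer, outer_mulVec,
    symOuter, mul_add, add_mul,
    outer_smul_left]
  module

/-- The derivative of `symOuter_tangent_identity` in the direction z' with ζ fixed. -/
theorem symOuter_tangent_identity' (z ζ z' : Fin n → ℂ) :
    outer z z * symOuter ζ z' + symOuter ζ z' * outer z z
        + (symOuter z z' * symOuter z ζ + symOuter z ζ * symOuter z z')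
      = (symOuter ζ z').trace • outer z z + (outer z z).trace • symOuter ζ z'
        + ((symOuter z z').trace • symOuter z ζ + (symOuter z ζ).trace • symOuter z z') := by
  simp only [Matrix.trace_add, trace_outer, mul_outer, outer_mulVec,
    symOuter, mul_add, add_mul,
    outer_smul_left]
  module

/-- Same method as for the cone: hermiticity of both entries, x² = (tr x) x and its linearization in
π are differentiated, and the reverse inclusion moves z and ζ along lines. -/
theorem mem_tangentAt_tangentBundle_iff {z ζ : Fin n → ℂ} (hz : z ≠ 0) {ξ : Mat n × Mat n} :
    ξ ∈ tangentAt (tangentBundle n) (bundlePoint z ζ) ↔ ∃ z' ζ', ξ = bundleVec z ζ z' ζ' := by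
  have hQ : bundlePoint z ζ ∈ tangentBundle n := mem_tangentBundle_iff.2 ⟨z, ζ, hz, rfl⟩
  constructor
  · intro hξ
    have hx : HasDerivAt (fun r : ℝ => (bundlePoint z ζ + r • ξ).1) ξ.1 0 :=
      hasDerivAt_line (outer z z) ξ.1
    have hp : HasDerivAt (fun r : ℝ => (bundlePoint z ζ + r • ξ).2) ξ.2 0 :=
      hasDerivAt_line (symOuter z ζ) ξ.2
    have d1 : Differentiable ℝ (fun Q : Mat n × Mat n => Q.1) := differentiable_fst
    have d2 : Differentiable ℝ (fun Q : Mat n × Mat n => Q.2) := differentiable_snd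
    have t1 : Differentiable ℝ (fun Q : Mat n × Mat n => Q.1.trace) := differentiable_trace.comp d1
    have t2 : Differentiable ℝ (fun Q : Mat n × Mat n => Q.2.trace) := differentiable_trace.comp d2
    have h1 : ξ.1ᴴ = ξ.1 := sub_eq_zero.1 <| deriv_eq_zero_of_mem_tangentAt
      (G := fun Q : Mat n × Mat n => Q.1ᴴ - Q.1)
      ((differentiable_conjTranspose.comp d1).sub d1).differentiableAt
      (fun y hy => sub_eq_zero.2 hy.1.1.1) hQ hξ ((hasDerivAt_conjTranspose hx).sub hx)
    have h2 : ξ.2ᴴ = ξ.2 := sub_eq_zero.1 <| deriv_eq_zero_of_mem_tangentAt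
      (G := fun Q : Mat n × Mat n => Q.2ᴴ - Q.2)
      ((differentiable_conjTranspose.comp d2).sub d2).differentiableAt
      (fun y hy => by
        obtain ⟨w, η, -, rfl⟩ := mem_tangentBundle_iff.1 hy
        exact sub_eq_zero.2 (conjTranspose_symOuter w η)) hQ hξ ((hasDerivAt_conjTranspose hp).sub hp)
    have h3 := deriv_eq_zero_of_mem_tangentAt
      (G := fun Q : Mat n × Mat n => Q.1 * Q.1 - Q.1.trace • Q.1)
      ((d1.mul d1).sub (t1.smul d1)).differentiableAt
      (fun y hy => by
        obtain ⟨w, η, -, rfl⟩ := mem_tangentBundle_iff.1 hy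
        exact sub_eq_zero.2 (outer_self_mul_self w)) hQ hξ ((hx.mul hx).sub ((hasDerivAt_trace hx).smul hx))
    have h4 := deriv_eq_zero_of_mem_tangentAt
      (G := fun Q : Mat n × Mat n =>
        Q.1 * Q.2 + Q.2 * Q.1 - (Q.2.trace • Q.1 + Q.1.trace • Q.2))
      (((d1.mul d2).add (d2.mul d1)).sub ((t2.smul d1).add (t1.smul d2))).differentiableAt
      (fun y hy => by
        obtain ⟨w, η, -, rfl⟩ := mem_tangentBundle_iff.1 hy
        exact sub_eq_zero.2 (symOuter_tangent_identity w η)) hQ hξ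
      (((hx.mul hp).add (hp.mul hx)).sub (((hasDerivAt_trace hp).smul hx).add ((hasDerivAt_trace hx).smul hp)))
    obtain ⟨a, b⟩ := ξ
    simp only [zero_smul, add_zero, bundlePoint] at h1 h2 h3 h4
    obtain ⟨z', rfl⟩ := exists_eq_symOuter (k := a) hz h1 (by
      rw [add_comm, add_comm (a.trace • _)]; exact sub_eq_zero.1 h3)
    -- The equation for b is inhomogeneous, and `symOuter ζ z'` is a particular solution; the
    -- difference solves the equation of the tangent space of the cone.
    obtain ⟨ζ', hζ'⟩ := exists_eq_symOuter (k := b - symOuter ζ z') hz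
      (by rw [Matrix.conjTranspose_sub, h2, conjTranspose_symOuter]) (by
        have h5 := symOuter_tangent_identity' z ζ z'
        rw [sub_eq_zero] at h4
        simp only [mul_sub, sub_mul, Matrix.trace_sub, sub_smul, smul_sub]
        linear_combination (norm := abel) h4 - h5)
    exact ⟨z', ζ', Prod.ext rfl (sub_eq_iff_eq_add.1 hζ')⟩
  · rintro ⟨z', ζ', rfl⟩
    refine mem_tangentAt_of_quadratic (η := (outer z' z', symOuter z' ζ')) ?_
    filter_upwards [eventually_add_smul_ne_zero hz z'] with r hr
    refine mem_tangentBundle_iff.2 ⟨_, ζ + (r : ℂ) • ζ', hr, ?_⟩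
    refine Prod.ext ?_ ?_
    · simp only [bundlePoint, bundleVec, symOuter, outer_add_left, outer_add_right,
        outer_smul_left, outer_smul_right, Complex.star_def, Complex.conj_ofReal,
        Prod.fst_add, Prod.smul_fst, ← Complex.coe_smul]
      module
    · simp only [bundlePoint, bundleVec, symOuter, outer_add_left, outer_add_right,
        outer_smul_left, outer_smul_right, Complex.star_def, Complex.conj_ofReal,
        Prod.snd_add, Prod.smul_snd, ← Complex.coe_smul]
      module

/-! ### The twisted symplectic form -/

theorem ip_eq_trace (u v : Mat n) : ip u v = (1 / (n : ℝ)) * (u * v).trace.re := by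
  simp only [ip, rtr, jordan, Matrix.trace_smul, Matrix.trace_add, Matrix.trace_mul_comm v u,
    Complex.real_smul, Complex.re_ofReal_mul, Complex.add_re]
  ring

theorem ip_add_left (u v w : Mat n) : ip (u + v) w = ip u w + ip v w := by
  simp only [ip_eq_trace, add_mul, Matrix.trace_add, Complex.add_re]
  ring

theorem ip_add_right (u v w : Mat n) : ip u (v + w) = ip u v + ip u w := by
  simp only [ip_eq_trace, mul_add, Matrix.trace_add, Complex.add_re]

theorem ip_smul_left (c : ℝ) (u v : Mat n) : ip (c • u) v = c * ip u v := by
  simp only [ip_eq_trace, smul_mul_assoc, Matrix.trace_smul, Complex.real_smul,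
    Complex.re_ofReal_mul]
  ring

theorem ip_smul_right (c : ℝ) (u v : Mat n) : ip u (c • v) = c * ip u v := by
  simp only [ip_eq_trace, mul_smul_comm, Matrix.trace_smul, Complex.real_smul,
    Complex.re_ofReal_mul]
  ring

theorem ip_zero_right (u : Mat n) : ip u 0 = 0 := by simp [ip_eq_trace]

theorem eq_zero_of_ip_self_eq_zero (hn : n ≠ 0) {k : Mat n} (hk : kᴴ = k) (h : ip k k = 0) :
    k = 0 := by
  have hn' : (n : ℝ) ≠ 0 := Nat.cast_ne_zero.2 hn
  rw [ip_eq_trace, mul_eq_zero, or_iff_right (by positivity)] at h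
  refine Matrix.trace_conjTranspose_mul_self_eq_zero_iff.1 ?_
  refine Complex.ext ?_ ?_
  · rw [hk, h, Complex.zero_re]
  · refine Complex.conj_eq_iff_im.1 ?_
    change star _ = _
    rw [← Matrix.trace_conjTranspose, Matrix.conjTranspose_mul, Matrix.conjTranspose_conjTranspose]

theorem keplerForm_add_left (x a b c : Mat n) :
    keplerForm x (a + b) c = keplerForm x a c + keplerForm x b c := by
  simp only [keplerForm, add_lie, mul_add, Matrix.trace_add, add_div, Complex.add_re]

theorem keplerForm_add_right (x a b c : Mat n) :
    keplerForm x a (b + c) = keplerForm x a b + keplerForm x a c := by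
  simp only [keplerForm, lie_add, mul_add, Matrix.trace_add, add_div, Complex.add_re]

theorem keplerForm_smul_left (r : ℝ) (x a b : Mat n) :
    keplerForm x (r • a) b = r * keplerForm x a b := by
  simp only [keplerForm, smul_lie, mul_smul_comm, Matrix.trace_smul, Complex.real_smul]
  rw [← Complex.re_ofReal_mul]
  congr 1
  ring

theorem keplerForm_smul_right (r : ℝ) (x a b : Mat n) :
    keplerForm x a (r • b) = r * keplerForm x a b := by
  simp only [keplerForm, lie_smul, mul_smul_comm, Matrix.trace_smul, Complex.real_smul]
  rw [← Complex.re_ofReal_mul]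
  congr 1
  ring

theorem keplerForm_zero_left (x b : Mat n) : keplerForm x 0 b = 0 := by
  simpa using keplerForm_smul_left 0 x 0 b

theorem keplerForm_zero_right (x a : Mat n) : keplerForm x a 0 = 0 := by
  simpa using keplerForm_smul_right 0 x a 0

theorem twistedForm_apply (μ : ℝ) (Q ξ η : Mat n × Mat n) :
    twistedForm μ Q ξ η = ip ξ.2 η.1 - ip η.2 ξ.1 + 2 * μ * keplerForm Q.1 ξ.1 η.1 := by
  rw [twistedForm, canonicalForm_apply]

/-- The twisted form as a bilinear form. -/
def twistedBilin (μ : ℝ) (Q : Mat n × Mat n) :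
    (Mat n × Mat n) →ₗ[ℝ] (Mat n × Mat n) →ₗ[ℝ] ℝ :=
  LinearMap.mk₂ ℝ (twistedForm μ Q)
    (fun a b c => by
      simp only [twistedForm_apply, Prod.fst_add, Prod.snd_add, ip_add_left, ip_add_right,
        keplerForm_add_left]
      ring)
    (fun r a b => by
      simp only [twistedForm_apply, Prod.smul_fst, Prod.smul_snd, ip_smul_left, ip_smul_right,
        keplerForm_smul_left, smul_eq_mul]
      ring)
    (fun a b c => by
      simp only [twistedForm_apply, Prod.fst_add, Prod.snd_add, ip_add_left, ip_add_right,
        keplerForm_add_right]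
      ring)
    (fun r a b => by
      simp only [twistedForm_apply, Prod.smul_fst, Prod.smul_snd, ip_smul_left, ip_smul_right,
        keplerForm_smul_right, smul_eq_mul]
      ring)

/-! ### Nondegeneracy and Hamiltonian vectors -/

theorem ne_zero_of_vector_ne_zero {z : Fin n → ℂ} (hz : z ≠ 0) : n ≠ 0 := by
  rintro rfl
  exact hz (Subsingleton.elim _ _)

theorem symOuter_zero_right (z : Fin n → ℂ) : symOuter z 0 = 0 := by simp [symOuter, outer]

theorem symOuter_add_right (z a b : Fin n → ℂ) :
    symOuter z (a + b) = symOuter z a + symOuter z b := by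
  simp only [symOuter, outer_add_left, outer_add_right]
  abel

theorem twistedForm_nondegenerate (μ : ℝ) {z ζ : Fin n → ℂ} (hz : z ≠ 0) {ξ : Mat n × Mat n}
    (hξ : ξ ∈ tangentAt (tangentBundle n) (bundlePoint z ζ))
    (h : ∀ η ∈ tangentAt (tangentBundle n) (bundlePoint z ζ),
      twistedForm μ (bundlePoint z ζ) ξ η = 0) : ξ = 0 := by
  have hn := ne_zero_of_vector_ne_zero hz
  have hT := fun {η} => @mem_tangentAt_tangentBundle_iff n z ζ hz η
  obtain ⟨z', ζ', rfl⟩ := hT.1 hξ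
  -- Test against the vertical vector (0, a), where a is the base component of ξ: the Kepler term
  -- drops out and ⟨a | a⟩ = 0 remains.
  have ha : symOuter z z' = 0 := by
    have h1 := h _ (hT.2 ⟨0, z', rfl⟩)
    simp only [twistedForm_apply, bundleVec, symOuter_zero_right, ip_zero_right, add_zero, zero_sub,
      keplerForm_zero_right, mul_zero, neg_eq_zero] at h1
    exact eq_zero_of_ip_self_eq_zero hn (conjTranspose_symOuter _ _) h1
  -- Once the base component vanishes, the fibre component is itself tangent to the cone, so it can
  -- serve as the base component of a second test vector.
  obtain ⟨σ, hσ⟩ := exists_eq_symOuter hz (conjTranspose_symOuter ζ z') (by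
    have h2 := symOuter_tangent_identity' z ζ z'
    simpa [ha] using h2)
  have hb : symOuter z ζ' + symOuter ζ z' = symOuter z (ζ' + σ) := by
    rw [symOuter_add_right, hσ]
  have h3 := h _ (hT.2 ⟨ζ' + σ, 0, rfl⟩)
  simp only [twistedForm_apply, bundleVec, ha, ip_zero_right, sub_zero,
      keplerForm_zero_left, mul_zero, add_zero, hb] at h3
  have h4 := eq_zero_of_ip_self_eq_zero hn (conjTranspose_symOuter _ _) h3
  exact Prod.ext ha (hb.trans h4)

/-- On the finite-dimensional tangent space an injective map to the dual is surjective, and `diff g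
Q` is a linear form there. -/
theorem existsUnique_isHamiltonianVector (μ : ℝ) (g : PhaseSpace n → ℝ) (Q : PhaseSpace n) :
    ∃! ξ, IsHamiltonianVector μ g Q ξ := by
  obtain ⟨z, ζ, hz, hQ⟩ := mem_tangentBundle_iff.1 Q.2
  have hnd : ∀ ξ ∈ phaseTangent Q, (∀ η ∈ phaseTangent Q, twistedForm μ Q ξ η = 0) → ξ = 0 := by
    unfold phaseTangent
    rw [hQ]
    exact fun ξ hξ h => twistedForm_nondegenerate μ hz hξ h
  let T := phaseTangent Q
  let B : T →ₗ[ℝ] Module.Dual ℝ T :=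
    ((LinearMap.lcomp ℝ ℝ T.subtype).comp (twistedBilin μ Q.1)).comp T.subtype
  have hB : ∀ ξ η : T, B ξ η = twistedForm μ Q.1 ξ.1 η.1 := fun _ _ => rfl
  have hinj : Function.Injective B := by
    rw [← LinearMap.ker_eq_bot, LinearMap.ker_eq_bot']
    intro ξ hξ
    refine Subtype.ext (hnd ξ ξ.2 fun η hη => ?_)
    rw [← hB ξ ⟨η, hη⟩, hξ]
    rfl
  have hsurj : Function.Surjective B :=
    (LinearMap.injective_iff_surjective_of_finrank_eq_finrank
      Subspace.dual_finrank_eq.symm).1 hinj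
  obtain ⟨ξ, hξ⟩ := hsurj (-((diff g Q : (Mat n × Mat n) →ₗ[ℝ] ℝ).comp T.subtype))
  refine ⟨ξ, ⟨ξ.2, fun η hη => ?_⟩, ?_⟩
  · rw [← hB ξ ⟨η, hη⟩, hξ]
    rfl
  · rintro ξ' ⟨h1, h2⟩
    have : (⟨ξ', h1⟩ : T) = ξ := hinj (by
      rw [hξ]
      ext η
      rw [hB, h2 _ η.2]
      rfl)
    rw [← this]

theorem poisson_apply_of_isHamiltonianVector {μ : ℝ} (f : PhaseSpace n → ℝ) {g : PhaseSpace n → ℝ}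
    {Q : PhaseSpace n} {ξ : Mat n × Mat n} (h : IsHamiltonianVector μ g Q ξ) :
    poisson μ f g Q = diff f Q ξ := by
  have hex : ∃ ξ, IsHamiltonianVector μ g Q ξ := ⟨ξ, h⟩
  rw [poisson, hamiltonianVector, dif_pos hex,
    (existsUnique_isHamiltonianVector μ g Q).unique hex.choose_spec h]

theorem isHamiltonianVector_hamiltonianVector (μ : ℝ) (g : PhaseSpace n → ℝ) (Q : PhaseSpace n) :
    IsHamiltonianVector μ g Q (hamiltonianVector μ g Q) := by
  have hex := (existsUnique_isHamiltonianVector μ g Q).exists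
  rw [hamiltonianVector, dif_pos hex]
  exact hex.choose_spec

/-! ### Linear coordinates on the total space of the `U(1)`-bundle -/

/-- The vector `w = π z + i n μ z / (z† z)`. The pair `(z, w)` covers the point
`bundlePoint z ζ`, and lies on the level `n μ` of the moment map `Im (z† w)`. -/
def mom (μ : ℝ) (z ζ : Fin n → ℂ) : Fin n → ℂ :=
  symOuter z ζ *ᵥ z + (Complex.I * n * μ * (hip z z)⁻¹) • z

/-- The derivative of `mom` at `(z, ζ)` in the direction `(z', ζ')`. -/
def momVec (μ : ℝ) (z ζ z' ζ' : Fin n → ℂ) : Fin n → ℂ :=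
  (symOuter z ζ' + symOuter ζ z') *ᵥ z + symOuter z ζ *ᵥ z'
    + (Complex.I * n * μ * (hip z z)⁻¹) • z'
    - (Complex.I * n * μ * (hip z z' + hip z' z) * (hip z z)⁻¹ ^ 2) • z

theorem ofReal_re_eq (c : ℂ) : (c.re : ℂ) = (c + star c) / 2 :=
  Complex.re_eq_add_conj c

/-- The magnetic term is absorbed by the shift from π z to w: the twisted form becomes constant in
(z, w), and μ survives only in the level of the moment map. -/
theorem twistedForm_bundleVec (μ : ℝ) {z : Fin n → ℂ} (hz : z ≠ 0) (ζ z' ζ' y η : Fin n → ℂ) :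
    twistedForm μ (bundlePoint z ζ) (bundleVec z ζ z' ζ') (bundleVec z ζ y η)
      = 2 / n * (hip (momVec μ z ζ z' ζ') y - hip z' (momVec μ z ζ y η)).re := by
  have hn : (n : ℂ) ≠ 0 := Nat.cast_ne_zero.2 (ne_zero_of_vector_ne_zero hz)
  have ht := hip_self_ne_zero hz
  apply Complex.ofReal_injective
  simp only [twistedForm_apply, bundlePoint, bundleVec, ip_eq_trace, keplerForm, Ring.lie_def]
  push_cast
  simp only [ofReal_re_eq, momVec, hip_add_left, hip_sub_left, hip_smul_left, hip_add_right,
    hip_sub_right, hip_smul_right, Matrix.add_mulVec, mul_sub, trace_outer,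
    Matrix.trace_add, Matrix.trace_sub, symOuter, mul_add, add_mul, mul_outer, outer_mul,
    conjTranspose_outer, outer_mulVec, Matrix.conjTranspose_smul,
    Matrix.smul_mulVec,
    outer_smul_left, outer_smul_right, Matrix.trace_smul, smul_eq_mul, star_add, star_sub,
    star_mul', star_div₀, star_hip, star_neg, star_pow, star_inv₀, Complex.star_def,
    Complex.conj_I, Complex.conj_ofReal, map_natCast]
  field_simp
  ring

/-! ### Quadratic observables -/

/-- Complex matrices of order `2 n`, in block form. -/
abbrev Mat2 (n : ℕ) : Type := Matrix (Fin n ⊕ Fin n) (Fin n ⊕ Fin n) ℂ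

/-- The matrix of the skew-hermitian form `(z, w), (z', w') ↦ w† z' - z† w'`. -/
def formK (n : ℕ) : Mat2 n := Matrix.fromBlocks 0 (-1) 1 0

/-- The matrix `π + i n μ / tr x`, which sends `z` to `mom μ z ζ`. -/
def shift (μ : ℝ) (Q : Mat n × Mat n) : Mat n := Q.2 + (Complex.I * n * μ * Q.1.trace⁻¹) • 1

theorem shift_mulVec (μ : ℝ) (z ζ : Fin n → ℂ) :
    shift μ (bundlePoint z ζ) *ᵥ z = mom μ z ζ := by
  simp [shift, bundlePoint, mom, Matrix.add_mulVec, Matrix.smul_mulVec, trace_outer]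

/-- This is why `obsFun` uses both signs of μ: z w† = x `shift (-μ)` and w w† = `shift μ` x `shift
(-μ)`, so the products of z and w descend to functions of (x, π). -/
theorem conjTranspose_shift_neg (μ : ℝ) (z ζ : Fin n → ℂ) :
    (shift (-μ) (bundlePoint z ζ))ᴴ = shift μ (bundlePoint z ζ) := by
  simp only [shift, bundlePoint, Matrix.conjTranspose_add, conjTranspose_symOuter,
    Matrix.conjTranspose_smul, Matrix.conjTranspose_one, trace_outer, star_mul', star_inv₀, star_hip]
  simp

/-- The quadratic observable attached to a matrix of order `2 n`, in terms of `(x, π)`. -/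
def obsFun (μ : ℝ) (M : Mat2 n) (Q : Mat n × Mat n) : ℝ :=
  1 / n * (M.toBlocks₁₁ * (Q.1 * shift (-μ) Q) + M.toBlocks₁₂ * (shift μ Q * Q.1 * shift (-μ) Q)
    - M.toBlocks₂₁ * Q.1 - M.toBlocks₂₂ * (shift μ Q * Q.1)).trace.re

/-- The quadratic observable `(1/n) Re (ψ† K M ψ)` on the phase space, where `ψ = (z, w)`. -/
def obs (μ : ℝ) : Mat2 n →ₗ[ℝ] PhaseSpace n → ℝ where
  toFun M Q := obsFun μ M Q
  map_add' M N := by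
    ext Q
    have h11 : (M + N).toBlocks₁₁ = M.toBlocks₁₁ + N.toBlocks₁₁ := rfl
    have h12 : (M + N).toBlocks₁₂ = M.toBlocks₁₂ + N.toBlocks₁₂ := rfl
    have h21 : (M + N).toBlocks₂₁ = M.toBlocks₂₁ + N.toBlocks₂₁ := rfl
    have h22 : (M + N).toBlocks₂₂ = M.toBlocks₂₂ + N.toBlocks₂₂ := rfl
    simp only [obsFun, h11, h12, h21, h22, add_mul, Matrix.trace_add, Matrix.trace_sub,
      Complex.add_re, Complex.sub_re, Pi.add_apply]
    ring
  map_smul' c M := by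
    ext Q
    have h11 : (c • M).toBlocks₁₁ = c • M.toBlocks₁₁ := rfl
    have h12 : (c • M).toBlocks₁₂ = c • M.toBlocks₁₂ := rfl
    have h21 : (c • M).toBlocks₂₁ = c • M.toBlocks₂₁ := rfl
    have h22 : (c • M).toBlocks₂₂ = c • M.toBlocks₂₂ := rfl
    simp only [obsFun, h11, h12, h21, h22, smul_mul_assoc, Matrix.trace_add, Matrix.trace_sub,
      Matrix.trace_smul, Complex.add_re, Complex.sub_re, Pi.smul_apply, Complex.real_smul,
      Complex.re_ofReal_mul, smul_eq_mul, RingHom.id_apply]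
    ring

theorem obs_apply (μ : ℝ) (M : Mat2 n) (Q : PhaseSpace n) : obs μ M Q = obsFun μ M Q := rfl

theorem hip_formK (a b c d : Fin n → ℂ) :
    hip (Sum.elim a b) (formK n *ᵥ Sum.elim c d) = hip b c - hip a d := by
  simp [hip, formK, Matrix.fromBlocks_mulVec, dotProduct, Matrix.neg_mulVec]
  ring

theorem obsFun_bundlePoint (μ : ℝ) (M : Mat2 n) (z ζ : Fin n → ℂ) :
    obsFun μ M (bundlePoint z ζ)
      = 1 / n * (hip (Sum.elim z (mom μ z ζ))
          (formK n *ᵥ (M *ᵥ Sum.elim z (mom μ z ζ)))).re := by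
  obtain ⟨a, b, c, d, rfl⟩ : ∃ a b c d, M = Matrix.fromBlocks a b c d :=
    ⟨_, _, _, _, (Matrix.fromBlocks_toBlocks M).symm⟩
  have hx : (bundlePoint z ζ).1 = outer z z := rfl
  simp only [obsFun, hx, Matrix.fromBlocks_mulVec, Sum.elim_comp_inl, Sum.elim_comp_inr, hip_formK,
    Matrix.toBlocks_fromBlocks₁₁, Matrix.toBlocks_fromBlocks₁₂, Matrix.toBlocks_fromBlocks₂₁,
    Matrix.toBlocks_fromBlocks₂₂, mul_outer, outer_mul, conjTranspose_shift_neg, shift_mulVec,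
    Matrix.trace_add, Matrix.trace_sub, trace_outer, hip_add_right]
  ring_nf

/-! ### Smoothness and differentials of the quadratic observables -/

theorem ne_zero_of_mem_tangentBundle {Q : Mat n × Mat n} (hQ : Q ∈ tangentBundle n) : n ≠ 0 := by
  obtain ⟨z, ζ, hz, rfl⟩ := mem_tangentBundle_iff.1 hQ
  exact ne_zero_of_vector_ne_zero hz

theorem trace_ne_zero_of_mem_tangentBundle {Q : Mat n × Mat n} (hQ : Q ∈ tangentBundle n) :
    Q.1.trace ≠ 0 := by
  obtain ⟨z, ζ, hz, rfl⟩ := mem_tangentBundle_iff.1 hQ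
  rw [bundlePoint, trace_outer]
  exact hip_self_ne_zero hz

theorem contDiffAt_shift (μ : ℝ) {Q : Mat n × Mat n} (hQ : Q.1.trace ≠ 0) :
    ContDiffAt ℝ ∞ (shift μ) Q := by
  have h1 : ContDiffAt ℝ ∞ (fun Q : Mat n × Mat n => Q.1.trace) Q :=
    ((traceL n).contDiff.comp contDiff_fst).contDiffAt
  exact contDiffAt_snd.add ((contDiffAt_const.mul (h1.inv hQ)).smul contDiffAt_const)

theorem contDiffAt_obsFun (μ : ℝ) (M : Mat2 n) {Q : Mat n × Mat n} (hQ : Q.1.trace ≠ 0) :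
    ContDiffAt ℝ ∞ (obsFun μ M) Q := by
  have h1 := contDiffAt_shift μ hQ
  have h2 := contDiffAt_shift (-μ) hQ
  have h3 : ContDiffAt ℝ ∞ (fun Q : Mat n × Mat n => Q.1) Q := contDiffAt_fst
  have h4 : ContDiff ℝ ∞ (fun k : Mat n => k.trace.re) :=
    (Complex.reCLM.comp (traceL n)).contDiff
  exact contDiffAt_const.mul (h4.contDiffAt.comp Q
    ((((contDiffAt_const.mul (h3.mul h2)).add (contDiffAt_const.mul ((h1.mul h3).mul h2))).sub
      (contDiffAt_const.mul h3)).sub (contDiffAt_const.mul (h1.mul h3))))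

theorem ext_apply (f : PhaseSpace n → ℝ) (Q : PhaseSpace n) : ext f Q = f Q :=
  Subtype.val_injective.extend_apply f 0 Q

theorem isSmooth_of_contDiffAt {f : PhaseSpace n → ℝ} {F : Mat n × Mat n → ℝ}
    (hf : ∀ Q, f Q = F Q) (hF : ∀ Q : PhaseSpace n, ContDiffAt ℝ ∞ F Q) : IsSmooth f := by
  intro Q hQ
  refine (hF ⟨Q, hQ⟩).contDiffWithinAt.congr (fun y hy => ?_) ?_
  · exact (ext_apply f ⟨y, hy⟩).trans (hf _)
  · exact (ext_apply f ⟨Q, hQ⟩).trans (hf _)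

theorem isSmooth_obs (μ : ℝ) (M : Mat2 n) : IsSmooth (obs μ M) :=
  isSmooth_of_contDiffAt (fun _ => rfl) fun Q =>
    contDiffAt_obsFun μ M (trace_ne_zero_of_mem_tangentBundle Q.2)

/-- Any differentiable ambient extension F may be differentiated along the straight line through Q,
even though that line need not stay in the phase space. -/
theorem diff_eq_of_hasDerivAt {f : PhaseSpace n → ℝ} {F : Mat n × Mat n → ℝ} {Q : PhaseSpace n}
    (hf : ∀ Q, f Q = F Q) (hF : DifferentiableAt ℝ F Q) {ξ : Mat n × Mat n}
    (hξ : ξ ∈ phaseTangent Q) {d : ℝ} (hd : HasDerivAt (fun r : ℝ => F (Q + r • ξ)) d 0) :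
    diff f Q ξ = d := by
  have h1 : HasFDerivWithinAt (ext f) (fderiv ℝ F Q) (tangentBundle n) Q :=
    hF.hasFDerivAt.hasFDerivWithinAt.congr (fun y hy => (ext_apply f ⟨y, hy⟩).trans (hf _))
      ((ext_apply f Q).trans (hf _))
  have h2 := eqOn_tangentAt h1.differentiableWithinAt.hasFDerivWithinAt h1 hξ
  have h3 : HasDerivAt (fun r : ℝ => F (Q + r • ξ)) (fderiv ℝ F Q ξ) 0 :=
    hF.hasFDerivAt.hasLineDerivAt ξ
  exact h2.trans (h3.unique hd)

theorem hasDerivAt_shift (μ : ℝ) {Q : Mat n × Mat n} (hQ : Q.1.trace ≠ 0) (ξ : Mat n × Mat n) :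
    HasDerivAt (fun r : ℝ => shift μ (Q + r • ξ))
      (ξ.2 - (Complex.I * n * μ * ξ.1.trace * Q.1.trace⁻¹ ^ 2) • 1) 0 := by
  have hx : HasDerivAt (fun r : ℝ => (Q + r • ξ).1) ξ.1 0 := hasDerivAt_line Q.1 ξ.1
  have hp : HasDerivAt (fun r : ℝ => (Q + r • ξ).2) ξ.2 0 := hasDerivAt_line Q.2 ξ.2
  have h := hp.add ((((hasDerivAt_trace hx).inv (by simpa using hQ)).const_mul
    (Complex.I * n * μ)).smul_const (1 : Mat n))
  refine h.congr_deriv ?_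
  simp only [zero_smul, add_zero, sub_eq_add_neg, ← neg_smul]
  congr 2
  rw [inv_pow, div_eq_mul_inv]
  ring

theorem momVec_eq (μ : ℝ) (z ζ z' ζ' : Fin n → ℂ) :
    momVec μ z ζ z' ζ' = ((bundleVec z ζ z' ζ').2 - (Complex.I * n * μ *
        (bundleVec z ζ z' ζ').1.trace * (bundlePoint z ζ).1.trace⁻¹ ^ 2) • (1 : Mat n)) *ᵥ z
      + shift μ (bundlePoint z ζ) *ᵥ z' := by
  simp only [momVec, bundleVec, bundlePoint, shift, trace_symOuter, trace_outer, Matrix.add_mulVec,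
    Matrix.sub_mulVec, Matrix.smul_mulVec, Matrix.one_mulVec]
  module

theorem hasDerivAt_obsFun (μ : ℝ) (M : Mat2 n) {z : Fin n → ℂ} (hz : z ≠ 0) (ζ z' ζ' : Fin n → ℂ) :
    HasDerivAt (fun r : ℝ => obsFun μ M (bundlePoint z ζ + r • bundleVec z ζ z' ζ'))
      (1 / n * (hip (Sum.elim z' (momVec μ z ζ z' ζ'))
            (formK n *ᵥ (M *ᵥ Sum.elim z (mom μ z ζ)))
          + hip (Sum.elim z (mom μ z ζ))
            (formK n *ᵥ (M *ᵥ Sum.elim z' (momVec μ z ζ z' ζ')))).re) 0 := by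
  obtain ⟨a, b, c, d, rfl⟩ : ∃ a b c d, M = Matrix.fromBlocks a b c d :=
    ⟨_, _, _, _, (Matrix.fromBlocks_toBlocks M).symm⟩
  have hQ : (bundlePoint z ζ).1.trace ≠ 0 := by
    rw [bundlePoint, trace_outer]
    exact hip_self_ne_zero hz
  have h1 := hasDerivAt_shift μ hQ (bundleVec z ζ z' ζ')
  have h2 := hasDerivAt_shift (-μ) hQ (bundleVec z ζ z' ζ')
  have hv := momVec_eq μ z ζ z' ζ'
  set A := (bundleVec z ζ z' ζ').2 - (Complex.I * n * μ *
        (bundleVec z ζ z' ζ').1.trace * (bundlePoint z ζ).1.trace⁻¹ ^ 2) • (1 : Mat n)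
  set B := (bundleVec z ζ z' ζ').2 - (Complex.I * n * (-μ : ℝ) *
        (bundleVec z ζ z' ζ').1.trace * (bundlePoint z ζ).1.trace⁻¹ ^ 2) • (1 : Mat n) with hB
  have hBA : Bᴴ = A := by
    simp only [hB, A, bundleVec, bundlePoint, Matrix.conjTranspose_sub, Matrix.conjTranspose_add,
      conjTranspose_symOuter, Matrix.conjTranspose_smul, Matrix.conjTranspose_one, trace_outer,
      trace_symOuter, star_mul', star_inv₀, star_pow, star_add, star_hip, Complex.star_def,
      Complex.conj_I, Complex.conj_ofReal, map_natCast]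
    push_cast
    congr 2
    ring
  have hx : HasDerivAt (fun r : ℝ => (bundlePoint z ζ + r • bundleVec z ζ z' ζ').1)
      (bundleVec z ζ z' ζ').1 0 := hasDerivAt_line _ _
  have h := ((((hx.mul h2).const_mul a).add (((h1.mul hx).mul h2).const_mul b)).sub
    (hx.const_mul c)).sub ((h1.mul hx).const_mul d)
  have h' := ((Complex.reCLM.hasFDerivAt.comp_hasDerivAt (0 : ℝ)
    (hasDerivAt_trace h))).const_mul (1 / (n : ℝ))
  have hx0 : (bundlePoint z ζ).1 = outer z z := rfl
  have ha0 : (bundleVec z ζ z' ζ').1 = symOuter z z' := rfl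
  refine h'.congr_deriv ?_
  simp only [Pi.mul_apply, zero_smul, add_zero]
  rw [hv]
  simp only [hx0, ha0, Matrix.fromBlocks_mulVec, Sum.elim_comp_inl, Sum.elim_comp_inr, hip_formK,
    mul_add, add_mul, symOuter, mul_outer, outer_mul, conjTranspose_shift_neg, hBA, shift_mulVec,
    Matrix.mulVec_add, hip_add_left,
    Matrix.trace_add, Matrix.trace_sub, trace_outer, hip_add_right, Complex.reCLM_apply]
  ring_nf

theorem diff_obs (μ : ℝ) (M : Mat2 n) {Q : PhaseSpace n} {z ζ : Fin n → ℂ} (hz : z ≠ 0)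
    (hQ : Q.1 = bundlePoint z ζ) (z' ζ' : Fin n → ℂ) :
    diff (obs μ M) Q (bundleVec z ζ z' ζ')
      = 1 / n * (hip (Sum.elim z' (momVec μ z ζ z' ζ'))
            (formK n *ᵥ (M *ᵥ Sum.elim z (mom μ z ζ)))
          + hip (Sum.elim z (mom μ z ζ))
            (formK n *ᵥ (M *ᵥ Sum.elim z' (momVec μ z ζ z' ζ')))).re := by
  refine diff_eq_of_hasDerivAt (fun _ => rfl)
    ((contDiffAt_obsFun μ M (trace_ne_zero_of_mem_tangentBundle Q.2)).differentiableAt (by simp))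
    ?_ ?_
  · rw [phaseTangent, hQ]
    exact (mem_tangentAt_tangentBundle_iff hz).2 ⟨z', ζ', rfl⟩
  · rw [hQ]
    exact hasDerivAt_obsFun μ M hz ζ z' ζ'

/-! ### Hamiltonian vectors of the quadratic observables -/

/-- The hypothesis `h` says that p† w + z† q is real, that is, (p, q) is tangent to the level set of
Im (z† w). Such vectors all come from the parametrization by (z, ζ). -/
theorem exists_momVec_eq (μ : ℝ) {z : Fin n → ℂ} (hz : z ≠ 0) (ζ p q : Fin n → ℂ)
    (h : hip p (mom μ z ζ) + hip z q = hip (mom μ z ζ) p + hip q z) :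
    ∃ ζ', momVec μ z ζ p ζ' = q := by
  have ht := hip_self_ne_zero hz
  set g := q - momVec μ z ζ p 0 with hg
  have hreal : hip g z = hip z g := by
    have hi : star ((hip z z)⁻¹) = (hip z z)⁻¹ := by rw [star_inv₀, star_hip]
    simp only [hg, momVec, mom, hip_add_left, hip_sub_left, hip_smul_left, hip_add_right,
      hip_sub_right, hip_smul_right, symOuter_mulVec, symOuter_zero_right,
      zero_add, star_add, star_mul', star_hip, hi, star_pow, Complex.star_def,
      Complex.conj_I, Complex.conj_ofReal, map_natCast] at h ⊢
    field_simp at h ⊢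
    linear_combination -h
  -- Since `momVec` is affine in ζ', it remains to solve (z† z) ζ' + (ζ'† z) z = g, which is
  -- possible because z† g is real.
  refine ⟨(hip z z)⁻¹ • (g - (hip z g / (2 * hip z z)) • z), ?_⟩
  have h1 : ∀ ζ', momVec μ z ζ p ζ' = symOuter z ζ' *ᵥ z + momVec μ z ζ p 0 := by
    intro ζ'
    simp only [momVec, Matrix.add_mulVec, symOuter_zero_right, Matrix.zero_mulVec]
    abel
  rw [h1, ← eq_sub_iff_add_eq, ← hg, symOuter_mulVec, hip_smul_left, hip_sub_left, hip_smul_left,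
    star_inv₀, star_div₀, star_mul', star_hip, star_hip, hreal, smul_smul, mul_inv_cancel₀ ht,
    one_smul]
  have h2 : (hip z z)⁻¹ * (hip z g - hip z g / (star 2 * hip z z) * hip z z)
      = hip z g / (2 * hip z z) := by
    simp only [star_ofNat]
    field_simp
    ring
  rw [h2]
  module

/-- The Lie algebra condition: `M` preserves the form with matrix `formK n`. -/
def PreservesFormK (M : Mat2 n) : Prop := Mᴴ * formK n + formK n * M = 0

theorem PreservesFormK.hip_mulVec {M : Mat2 n} (hM : PreservesFormK M) (a b : Fin n ⊕ Fin n → ℂ) :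
    hip (M *ᵥ a) (formK n *ᵥ b) = -hip a (formK n *ᵥ (M *ᵥ b)) := by
  rw [hip_mulVec_left, Matrix.mulVec_mulVec, Matrix.mulVec_mulVec,
    eq_neg_of_add_eq_zero_left hM, Matrix.neg_mulVec, hip_neg_right]

theorem star_hip_formK (a b : Fin n ⊕ Fin n → ℂ) :
    star (hip a (formK n *ᵥ b)) = -hip b (formK n *ᵥ a) := by
  have : (formK n)ᴴ = -formK n := by
    simp [formK, Matrix.fromBlocks_conjTranspose, Matrix.fromBlocks_neg]
  rw [star_hip, hip_mulVec_left, this, Matrix.neg_mulVec, hip_neg_right]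

theorem hip_formK_re_comm (a b : Fin n ⊕ Fin n → ℂ) :
    (hip a (formK n *ᵥ b)).re = -(hip b (formK n *ᵥ a)).re := by
  rw [← Complex.neg_re, ← star_hip_formK]
  simp

/-- As M is skew for K, the vector M ψ is tangent to the level set, and both terms of the
differential of (1/n) Re (ψ† K M ψ) along φ agree, giving (2/n) Re (ψ† K M φ) = -(2/n) Re ((M ψ)† K
φ). -/
theorem exists_isHamiltonianVector_obs (μ : ℝ) {M : Mat2 n} (hM : PreservesFormK M)
    {Q : PhaseSpace n} {z ζ : Fin n → ℂ} (hz : z ≠ 0) (hQ : Q.1 = bundlePoint z ζ) :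
    ∃ z' ζ', IsHamiltonianVector μ (obs μ M) Q (bundleVec z ζ z' ζ') ∧
      Sum.elim z' (momVec μ z ζ z' ζ') = M *ᵥ Sum.elim z (mom μ z ζ) := by
  obtain ⟨p, q, hpq⟩ : ∃ p q, M *ᵥ Sum.elim z (mom μ z ζ) = Sum.elim p q :=
    ⟨_, _, (Sum.elim_comp_inl_inr _).symm⟩
  obtain ⟨ζ', hζ'⟩ := exists_momVec_eq μ hz ζ p q (by
    have h := hM.hip_mulVec (Sum.elim z (mom μ z ζ)) (Sum.elim z (mom μ z ζ))
    rw [hpq, hip_formK, hip_formK] at h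
    linear_combination -h)
  refine ⟨p, ζ', ⟨?_, ?_⟩, by rw [hζ', hpq]⟩
  · rw [phaseTangent, hQ]
    exact (mem_tangentAt_tangentBundle_iff hz).2 ⟨p, ζ', rfl⟩
  · intro η hη
    rw [phaseTangent, hQ, mem_tangentAt_tangentBundle_iff hz] at hη
    obtain ⟨y, σ, rfl⟩ := hη
    rw [diff_obs μ M hz hQ, hQ, twistedForm_bundleVec μ hz, ← hip_formK, hζ', ← hpq,
      Complex.add_re, hip_formK_re_comm _ (M *ᵥ _), hM.hip_mulVec, Complex.neg_re]
    ring

/-- Differentiating ψ† K M ψ along ψ' = N ψ and moving N across K produces ψ† K (M N - N M) ψ. -/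
theorem poisson_obs (μ : ℝ) (M : Mat2 n) {N : Mat2 n} (hN : PreservesFormK N) :
    poisson μ (obs μ M) (obs μ N) = obs μ (M * N - N * M) := by
  ext Q
  obtain ⟨z, ζ, hz, hQ⟩ := mem_tangentBundle_iff.1 Q.2
  obtain ⟨z', ζ', h1, h2⟩ := exists_isHamiltonianVector_obs μ hN hz hQ
  rw [poisson_apply_of_isHamiltonianVector _ h1, diff_obs μ M hz hQ, h2, hN.hip_mulVec, obs_apply,
    hQ, obsFun_bundlePoint, Matrix.sub_mulVec, Matrix.mulVec_sub, hip_sub_right,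
    ← Matrix.mulVec_mulVec, ← Matrix.mulVec_mulVec]
  ring_nf

/-! ### The generators of the conformal algebra -/

/-- The generator whose observable is `X_u`. -/
def genX (u : Mat n) : Mat2 n := Matrix.fromBlocks 0 u 0 0

/-- The generator whose observable is `Y_v`. -/
def genY (v : Mat n) : Mat2 n := Matrix.fromBlocks 0 0 (-v) 0

/-- The block diagonal generators; `S_{uv}` is the observable of `genS (u v / 2)`. -/
def genS : Mat n →ₗ[ℝ] Mat2 n where
  toFun a := Matrix.fromBlocks a 0 0 (-aᴴ)
  map_add' a b := by
    simp [Matrix.fromBlocks_add, add_comm]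
  map_smul' c a := by
    simp [Matrix.fromBlocks_smul]

theorem genS_apply (a : Mat n) : genS a = Matrix.fromBlocks a 0 0 (-aᴴ) := rfl

/-- The block form of the grading of the conformal algebra: b carries X, c carries Y, and the
diagonal carries S. -/
theorem preservesFormK_iff {a b c d : Mat n} :
    PreservesFormK (Matrix.fromBlocks a b c d) ↔ bᴴ = b ∧ cᴴ = c ∧ d = -aᴴ := by
  rw [PreservesFormK, formK, Matrix.fromBlocks_conjTranspose, Matrix.fromBlocks_multiply,
    Matrix.fromBlocks_multiply, Matrix.fromBlocks_add, ← Matrix.fromBlocks_zero,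
    Matrix.fromBlocks_inj]
  simp only [mul_zero, mul_one, mul_neg, neg_mul, one_mul, zero_mul, zero_add, add_zero]
  constructor
  · rintro ⟨h1, h2, -, h4⟩
    refine ⟨(neg_add_eq_zero.1 h4), ?_, ?_⟩
    · exact add_neg_eq_zero.1 h1
    · rw [← neg_add_eq_zero, add_comm, ← neg_eq_zero, neg_add, neg_neg, neg_neg, add_comm]
      rw [← neg_eq_zero] at h2
      simpa [add_comm] using h2
  · rintro ⟨h1, h2, rfl⟩
    simp [h1, h2]

theorem preservesFormK_genX {u : Mat n} (hu : u.IsHermitian) : PreservesFormK (genX u) :=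
  preservesFormK_iff.2 ⟨hu, by simp, by simp⟩

theorem preservesFormK_genY {v : Mat n} (hv : v.IsHermitian) : PreservesFormK (genY v) :=
  preservesFormK_iff.2 ⟨by simp, by rw [Matrix.conjTranspose_neg, hv], by simp⟩

theorem preservesFormK_genS (a : Mat n) : PreservesFormK (genS a) :=
  preservesFormK_iff.2 ⟨by simp, by simp, rfl⟩

theorem str_eq (u v w : Mat n) : str u v w = (1 / 2 : ℝ) • (u * v * w + w * v * u) := by
  simp only [str, jordan, smul_add, mul_add, add_mul, mul_smul_comm, smul_mul_assoc, mul_assoc]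
  module

theorem isHermitian_str {u v w : Mat n} (hu : u.IsHermitian) (hv : v.IsHermitian)
    (hw : w.IsHermitian) : (str u v w).IsHermitian := by
  rw [Matrix.IsHermitian, str_eq, Matrix.conjTranspose_smul, Matrix.conjTranspose_add]
  simp only [Matrix.conjTranspose_mul, hu.eq, hv.eq, hw.eq, mul_assoc, star_trivial]
  rw [add_comm]

theorem conjTranspose_fst (Q : PhaseSpace n) : Q.1.1ᴴ = Q.1.1 := Q.2.1.1.1

theorem ofReal_rtr {x : Mat n} (hx : xᴴ = x) : ((rtr x : ℝ) : ℂ) = x.trace :=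
  Complex.conj_eq_iff_re.1 (trace_im_eq_zero hx)

theorem rtr_ne_zero (Q : PhaseSpace n) : rtr Q.1.1 ≠ 0 := by
  have h := trace_ne_zero_of_mem_tangentBundle Q.2
  rw [← ofReal_rtr (conjTranspose_fst Q)] at h
  exact_mod_cast h

theorem rtr_jordan (u v : Mat n) : rtr (jordan u v) = (u * v).trace.re := by
  simp only [rtr, jordan, Matrix.trace_smul, Matrix.trace_add, Matrix.trace_mul_comm v u,
    Complex.real_smul, Complex.re_ofReal_mul, Complex.add_re]
  ring

/-- The observable is (1/n) Re (w† u w). Inserting w = (π + i n μ / tr x) z, the terms of degree 0,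
1 and 2 in μ are the three summands of X_u. -/
theorem fX_eq_obs (μ : ℝ) (u : Mat n) : fX μ u = obs μ (genX u) := by
  ext ⟨⟨x, p⟩, hQ⟩
  have ht : rtr x ≠ 0 := rtr_ne_zero ⟨(x, p), hQ⟩
  have hn : (n : ℝ) ≠ 0 := Nat.cast_ne_zero.2 (ne_zero_of_mem_tangentBundle hQ)
  have hx : x.trace = ((rtr x : ℝ) : ℂ) := (ofReal_rtr (conjTranspose_fst ⟨(x, p), hQ⟩)).symm
  have e1 : (x * (p * u * p)).trace = (u * (p * (x * p))).trace := by
    rw [mul_assoc, ← mul_assoc, Matrix.trace_mul_comm, mul_assoc]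
  have e2 : (x * (u * p)).trace = (u * (p * x)).trace := by
    rw [Matrix.trace_mul_comm, mul_assoc]
  have e3 : (x * (p * u)).trace = (u * (x * p)).trace := by
    rw [← mul_assoc, Matrix.trace_mul_comm]
  have e4 : (x * u).trace = (u * x).trace := Matrix.trace_mul_comm _ _
  simp only [fX, obs_apply, obsFun, genX, Matrix.toBlocks_fromBlocks₁₁,
    Matrix.toBlocks_fromBlocks₁₂, Matrix.toBlocks_fromBlocks₂₁, Matrix.toBlocks_fromBlocks₂₂,
    zero_mul, zero_add, sub_zero, shift, str_eq, ip_eq_trace, rtr_jordan, Ring.lie_def, hx]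
  rw [← two_smul ℝ (p * u * p), smul_smul]
  norm_num only [one_smul]
  simp only [mul_add, add_mul, mul_sub, smul_mul_assoc, mul_smul_comm, one_mul, mul_one,
    Matrix.trace_add, Matrix.trace_sub, Matrix.trace_smul, smul_eq_mul, smul_add, mul_assoc] at e1 e2 e3 e4 ⊢
  rw [e1, e2, e3, e4]
  simp only [← Complex.ofReal_inv, Complex.add_re, Complex.sub_re, Complex.neg_re,
    Complex.neg_im, Complex.mul_re, Complex.mul_im, Complex.I_re, Complex.I_im,
    Complex.ofReal_re, Complex.ofReal_im, Complex.natCast_re, Complex.natCast_im,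
    Complex.ofReal_neg]
  field_simp
  ring

theorem fY_eq_obs (μ : ℝ) (v : Mat n) : fY v = obs μ (genY v) := by
  ext Q
  simp [fY, obs_apply, obsFun, genY, ip_eq_trace]

theorem fS_eq_obs (μ : ℝ) {u v : Mat n} (hu : u.IsHermitian) (hv : v.IsHermitian) :
    fS μ u v = obs μ (genS ((1 / 2 : ℝ) • (u * v))) := by
  ext ⟨⟨x, p⟩, hQ⟩
  have ht : rtr x ≠ 0 := rtr_ne_zero ⟨(x, p), hQ⟩
  have hn : (n : ℝ) ≠ 0 := Nat.cast_ne_zero.2 (ne_zero_of_mem_tangentBundle hQ)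
  have hx : x.trace = ((rtr x : ℝ) : ℂ) := (ofReal_rtr (conjTranspose_fst ⟨(x, p), hQ⟩)).symm
  have e1 : (v * (u * (p * x))).trace = (x * (v * (u * p))).trace := by
    rw [← mul_assoc, ← mul_assoc, Matrix.trace_mul_comm, mul_assoc]
  have e2 : (u * (v * x)).trace = (x * (u * v)).trace := by
    rw [← mul_assoc, Matrix.trace_mul_comm]
  have e3 : (v * (u * x)).trace = (x * (v * u)).trace := by
    rw [← mul_assoc, Matrix.trace_mul_comm]
  simp only [fS, obs_apply, obsFun, genS_apply, Matrix.toBlocks_fromBlocks₁₁,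
    Matrix.toBlocks_fromBlocks₁₂, Matrix.toBlocks_fromBlocks₂₁, Matrix.toBlocks_fromBlocks₂₂,
    zero_mul, add_zero, sub_zero, shift, str_eq, ip_eq_trace, Ring.lie_def, hx,
    Matrix.conjTranspose_smul, Matrix.conjTranspose_mul, hu.eq, hv.eq, star_trivial]
  simp only [mul_add, add_mul, mul_sub, smul_mul_assoc, mul_smul_comm, one_mul, mul_one, neg_mul,
    Matrix.trace_add, Matrix.trace_sub, Matrix.trace_smul, Matrix.trace_neg, smul_add, mul_assoc]
  rw [e1, e2, e3]
  simp only [← Complex.ofReal_inv, Complex.add_re, Complex.sub_re, Complex.neg_re,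
    Complex.neg_im, Complex.mul_re, Complex.mul_im, Complex.I_re, Complex.I_im,
    Complex.ofReal_re, Complex.ofReal_im, Complex.natCast_re, Complex.natCast_im, Complex.smul_re,
    Complex.smul_im, smul_eq_mul, Complex.ofReal_neg]
  field_simp
  ring

theorem genX_comm_genX (u v : Mat n) : genX u * genX v - genX v * genX u = 0 := by
  simp [genX, Matrix.fromBlocks_multiply]

theorem genY_comm_genY (u v : Mat n) : genY u * genY v - genY v * genY u = 0 := by
  simp [genY, Matrix.fromBlocks_multiply]

theorem genX_comm_genY {u v : Mat n} (hu : u.IsHermitian) (hv : v.IsHermitian) :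
    genX u * genY v - genY v * genX u = (-2 : ℝ) • genS ((1 / 2 : ℝ) • (u * v)) := by
  rw [← map_smul, smul_smul]
  norm_num only [neg_smul, one_smul]
  simp [genX, genY, genS_apply, Matrix.fromBlocks_multiply, sub_eq_add_neg, Matrix.fromBlocks_neg,
    Matrix.fromBlocks_add, hu.eq, hv.eq]

theorem genS_comm_genX {u v : Mat n} (hu : u.IsHermitian) (hv : v.IsHermitian) (z : Mat n) :
    genS ((1 / 2 : ℝ) • (u * v)) * genX z - genX z * genS ((1 / 2 : ℝ) • (u * v))
      = genX (str u v z) := by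
  simp [-map_smul, Matrix.fromBlocks_smul, genX, genS_apply, Matrix.fromBlocks_multiply, sub_eq_add_neg, Matrix.fromBlocks_neg,
    Matrix.fromBlocks_add, hu.eq, hv.eq, str_eq, mul_assoc]

theorem genS_comm_genY {u v : Mat n} (hu : u.IsHermitian) (hv : v.IsHermitian) (z : Mat n) :
    genS ((1 / 2 : ℝ) • (u * v)) * genY z - genY z * genS ((1 / 2 : ℝ) • (u * v))
      = -genY (str v u z) := by
  simp [-map_smul, Matrix.fromBlocks_smul, genY, genS_apply, Matrix.fromBlocks_multiply, sub_eq_add_neg, Matrix.fromBlocks_neg,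
    Matrix.fromBlocks_add, hu.eq, hv.eq, str_eq, mul_assoc]

theorem genS_comm_genS (a b : Mat n) :
    genS a * genS b - genS b * genS a = genS (a * b - b * a) := by
  simp [genS_apply, Matrix.fromBlocks_multiply, sub_eq_add_neg, Matrix.fromBlocks_neg,
    Matrix.fromBlocks_add]

/-- With {u v z} = (u·v·z + z·v·u)/2, the terms z·v·u·w on the right cancel, leaving a quarter of
the commutator of u·v and z·w. -/
theorem half_mul_comm_half_mul (u v z w : Mat n) :
    (1 / 2 : ℝ) • (u * v) * (1 / 2 : ℝ) • (z * w) - (1 / 2 : ℝ) • (z * w) * (1 / 2 : ℝ) • (u * v)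
      = (1 / 2 : ℝ) • (str u v z * w) - (1 / 2 : ℝ) • (z * str v u w) := by
  simp only [str_eq, smul_mul_assoc, mul_smul_comm, mul_add, add_mul, mul_assoc]
  module

theorem poisson_relations (μ : ℝ) {u v z w : Mat n} (hu : u.IsHermitian) (hv : v.IsHermitian)
    (hz : z.IsHermitian) (hw : w.IsHermitian) :
    poisson μ (fX μ u) (fX μ v) = 0 ∧ poisson μ (fY u) (fY v) = 0 ∧
    poisson μ (fX μ u) (fY v) = (-2 : ℝ) • fS μ u v ∧
    poisson μ (fS μ u v) (fX μ z) = fX μ (str u v z) ∧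
    poisson μ (fS μ u v) (fY z) = -fY (str v u z) ∧
    poisson μ (fS μ u v) (fS μ z w) = fS μ (str u v z) w - fS μ z (str v u w) := by
  refine ⟨?_, ?_, ?_, ?_, ?_, ?_⟩
  · rw [fX_eq_obs, fX_eq_obs, poisson_obs μ _ (preservesFormK_genX hv), genX_comm_genX, map_zero]
  · rw [fY_eq_obs μ, fY_eq_obs μ, poisson_obs μ _ (preservesFormK_genY hv), genY_comm_genY,
      map_zero]
  · rw [fX_eq_obs, fY_eq_obs μ, fS_eq_obs μ hu hv, poisson_obs μ _ (preservesFormK_genY hv),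
      genX_comm_genY hu hv, map_smul]
  · rw [fS_eq_obs μ hu hv, fX_eq_obs, fX_eq_obs, poisson_obs μ _ (preservesFormK_genX hz),
      genS_comm_genX hu hv]
  · rw [fS_eq_obs μ hu hv, fY_eq_obs μ, fY_eq_obs μ, poisson_obs μ _ (preservesFormK_genY hz),
      genS_comm_genY hu hv, map_neg]
  · rw [fS_eq_obs μ hu hv, fS_eq_obs μ hz hw, fS_eq_obs μ (isHermitian_str hu hv hz) hw,
      fS_eq_obs μ hz (isHermitian_str hv hu hw), poisson_obs μ _ (preservesFormK_genS _),
      genS_comm_genS, half_mul_comm_half_mul, map_sub, map_sub]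

/-! ### The isomorphism with `su(n, n)` -/

/-- The change of basis taking the hermitian form `formJ n` to a multiple of `formK n`. -/
def cayley (n : ℕ) : Mat2 n :=
  Matrix.fromBlocks 1 1 ((-Complex.I) • 1) (Complex.I • 1)

/-- The inverse of `cayley n`. -/
def cayleyInv (n : ℕ) : Mat2 n :=
  (1 / 2 : ℂ) • Matrix.fromBlocks 1 (Complex.I • 1) 1 ((-Complex.I) • 1)

theorem cayleyInv_mul_cayley : cayleyInv n * cayley n = 1 := by
  simp only [cayley, cayleyInv, Matrix.fromBlocks_multiply, mul_one, smul_smul,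
    Matrix.fromBlocks_smul, ← Matrix.fromBlocks_one, mul_smul_comm]
  congr 1 <;> match_scalars <;> ring_nf <;> norm_num [Complex.I_sq]

theorem cayley_mul_cayleyInv : cayley n * cayleyInv n = 1 :=
  mul_eq_one_comm.1 cayleyInv_mul_cayley

theorem cayley_formK : (cayley n)ᴴ * formK n * cayley n = (2 * Complex.I) • formJ n := by
  simp only [cayley, formK, formJ, Matrix.fromBlocks_conjTranspose, Matrix.fromBlocks_multiply,
    Matrix.fromBlocks_smul, Matrix.conjTranspose_smul, Matrix.conjTranspose_one]
  congr 1 <;> simp <;> module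

theorem preservesFormK_cayley_iff {A : Mat2 n} :
    PreservesFormK (cayley n * A * cayleyInv n) ↔ Aᴴ * formJ n + formJ n * A = 0 := by
  have h1 := cayley_mul_cayleyInv (n := n)
  have h2 := cayleyInv_mul_cayley (n := n)
  have h1' : (cayleyInv n)ᴴ * (cayley n)ᴴ = 1 := by
    rw [← Matrix.conjTranspose_mul, h1, Matrix.conjTranspose_one]
  have hI : (2 * Complex.I) ≠ 0 := by simp
  generalize hM : cayley n * A * cayleyInv n = M
  have hA : A = cayleyInv n * M * cayley n := by
    rw [← hM, mul_assoc, mul_assoc, mul_assoc, h2, mul_one, ← mul_assoc, h2, one_mul]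
  -- The two invariance conditions are congruent under the invertible Cayley matrix, up to the
  -- factor 2 i of `cayley_formK`.
  have key : (cayley n)ᴴ * (Mᴴ * formK n + formK n * M) * cayley n
      = (2 * Complex.I) • (Aᴴ * formJ n + formJ n * A) := by
    rw [smul_add, ← mul_smul_comm, ← smul_mul_assoc, ← cayley_formK, hA]
    simp only [Matrix.conjTranspose_mul]
    calc _ = (cayley n)ᴴ * Mᴴ * 1 * formK n * cayley n
          + (cayley n)ᴴ * formK n * 1 * M * cayley n := by noncomm_ring
      _ = _ := by
        nth_rewrite 1 [← h1']
        rw [← h1]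
        noncomm_ring
  constructor
  · intro h
    rw [h, mul_zero, zero_mul] at key
    exact (smul_eq_zero.1 key.symm).resolve_left hI
  · intro h
    rw [h, smul_zero] at key
    change Mᴴ * formK n + formK n * M = 0
    calc _ = (cayleyInv n)ᴴ * ((cayley n)ᴴ * (Mᴴ * formK n + formK n * M) * cayley n)
            * cayleyInv n := by
          rw [← mul_assoc, ← mul_assoc, h1', one_mul, mul_assoc, h1, mul_one]
      _ = 0 := by rw [key, mul_zero, zero_mul]

/-- The Poisson realization of `su(n, n)`. -/
def realization (μ : ℝ) : su n →ₗ[ℝ] PhaseSpace n → ℝ :=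
  (obs μ).comp (((LinearMap.mulRight ℝ (cayleyInv n)).comp
    (LinearMap.mulLeft ℝ (cayley n))).comp (su n).toSubmodule.subtype)

theorem realization_apply (μ : ℝ) (A : su n) :
    realization μ A = obs μ (cayley n * A.1 * cayleyInv n) := rfl

theorem realization_lie (μ : ℝ) (A B : su n) :
    realization μ ⁅A, B⁆ = poisson μ (realization μ A) (realization μ B) := by
  have h2 := cayleyInv_mul_cayley (n := n)
  rw [realization_apply, realization_apply, realization_apply,
    poisson_obs μ _ (preservesFormK_cayley_iff.2 B.2.1), LieSubalgebra.coe_bracket, Ring.lie_def]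
  congr 1
  have h : ∀ X Y : Mat2 n, cayley n * X * cayleyInv n * (cayley n * Y * cayleyInv n)
      = cayley n * (X * Y) * cayleyInv n := by
    intro X Y
    calc _ = cayley n * X * (cayleyInv n * cayley n) * Y * cayleyInv n := by noncomm_ring
      _ = _ := by rw [h2]; noncomm_ring
  rw [h, h, mul_sub, sub_mul]

theorem exists_mem_su {M : Mat2 n} (hM : PreservesFormK M) (ht : M.trace = 0) :
    ∃ A : su n, cayley n * A.1 * cayleyInv n = M := by
  have h1 := cayley_mul_cayleyInv (n := n)
  have h : cayley n * (cayleyInv n * M * cayley n) * cayleyInv n = M := by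
    rw [mul_assoc, mul_assoc, mul_assoc, h1, mul_one, ← mul_assoc, h1, one_mul]
  refine ⟨⟨cayleyInv n * M * cayley n, ?_, ?_⟩, h⟩
  · rw [← preservesFormK_cayley_iff, h]
    exact hM
  · rw [Matrix.trace_mul_comm, ← mul_assoc, h1, one_mul, ht]

theorem trace_fromBlocks (a b c d : Mat n) :
    (Matrix.fromBlocks a b c d).trace = a.trace + d.trace := by
  simp [Matrix.trace]

/-- Hence the trace condition of su(n, n) says exactly that tr a is real. -/
theorem trace_genS (a : Mat n) : (genS a).trace = a.trace - star a.trace := by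
  rw [genS_apply, trace_fromBlocks, Matrix.trace_neg, Matrix.trace_conjTranspose,
    sub_eq_add_neg]

/-- Real multiples of products of two hermitian matrices span the matrices of real trace. -/
theorem mem_span_hermitian_mul {a : Mat n} (ha : a.trace.im = 0) :
    a ∈ Submodule.span ℝ {m : Mat n | ∃ u v : Mat n, u.IsHermitian ∧ v.IsHermitian ∧ m = u * v} := by
  classical
  set D := Submodule.span ℝ {m : Mat n | ∃ u v : Mat n, u.IsHermitian ∧ v.IsHermitian ∧ m = u * v}
  have hD : ∀ {u v : Mat n}, u.IsHermitian → v.IsHermitian → u * v ∈ D := fun hu hv =>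
    Submodule.subset_span ⟨_, _, hu, hv, rfl⟩
  let E (i j : Fin n) (c : ℂ) : Mat n := Matrix.single i j c
  have hsym : ∀ (i j : Fin n) (c : ℂ), (E i j c + E j i (star c)).IsHermitian := by
    intro i j c
    simp only [E, Matrix.IsHermitian, Matrix.conjTranspose_add, Matrix.conjTranspose_single,
      star_star]
    exact add_comm _ _
  have hdiag : ∀ i : Fin n, (E i i 1).IsHermitian := by
    intro i
    simp [E, Matrix.IsHermitian, Matrix.conjTranspose_single]
  have hoff : ∀ (i j : Fin n) (c : ℂ), i ≠ j → E i j c ∈ D := by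
    intro i j c hij
    have := hD (hdiag i) (hsym i j c)
    simpa [E, mul_add, hij] using this
  have hre : ∀ (i : Fin n) (r : ℝ), E i i r ∈ D := by
    intro i r
    have := D.smul_mem r (hD (hdiag i) (hdiag i))
    simpa [E, Matrix.smul_single] using this
  have him : ∀ (i j : Fin n) (r : ℝ), E i i (r * Complex.I) - E j j (r * Complex.I) ∈ D := by
    intro i j r
    by_cases hij : i = j
    · subst hij
      simp
    -- For i ≠ j the product (E_ij + E_ji)(i E_ij - i E_ji) is -i E_ii + i E_jj.
    have := D.smul_mem (-r) (hD (hsym i j 1) (hsym i j Complex.I))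
    simpa [E, mul_add, add_mul, hij, Ne.symm hij, Matrix.smul_single, smul_add, sub_eq_add_neg,
      ← Matrix.single_neg, add_comm] using this
  rcases isEmpty_or_nonempty (Fin n) with hn | ⟨⟨o⟩⟩
  · rw [Subsingleton.elim a 0]
    exact D.zero_mem
  have hsum : ∑ i, (a i i).im = 0 := by
    rw [← ha, Matrix.trace, Complex.im_sum]
    rfl
  -- The imaginary parts of the diagonal entries sum to zero, so all of them may be balanced against
  -- one fixed diagonal position o at no cost.
  have hcorr : ∑ i, E o o ((a i i).im * Complex.I) = 0 := by
    have h (c : ℂ) : E o o c = c • E o o 1 := by simp [E, Matrix.smul_single]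
    simp only [h (_ * _)]
    rw [← Finset.sum_smul, ← Finset.sum_mul, ← Complex.ofReal_sum, hsum]
    simp
  have hdec : a = ∑ i, ∑ j, if i = j then
      E i i ((a i i).re : ℝ) + (E i i ((a i i).im * Complex.I) - E o o ((a i i).im * Complex.I))
      else E i j (a i j) := by
    have h (i j : Fin n) : (if i = j then
        E i i ((a i i).re : ℝ) + (E i i ((a i i).im * Complex.I) - E o o ((a i i).im * Complex.I))
        else E i j (a i j)) = E i j (a i j) - if i = j then E o o ((a i i).im * Complex.I) else 0 := by
      split_ifs with hij
      · subst hij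
        rw [← add_sub_assoc, ← Matrix.single_add, Complex.re_add_im]
      · rw [sub_zero]
    simp only [h, Finset.sum_sub_distrib, Finset.sum_ite_eq, Finset.mem_univ, if_true, hcorr,
      sub_zero]
    exact Matrix.matrix_eq_sum_single a
  rw [hdec]
  refine D.sum_mem fun i _ => D.sum_mem fun j _ => ?_
  split_ifs with hij
  · exact D.add_mem (hre i _) (him i o _)
  · exact hoff i j _ hij

theorem range_realization (μ : ℝ) :
    LinearMap.range (realization (n := n) μ) = Submodule.span ℝ
      {f | ∃ u v : Mat n, u.IsHermitian ∧ v.IsHermitian ∧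
        (f = fX μ u ∨ f = fY u ∨ f = fS μ u v)} := by
  apply le_antisymm
  · rintro _ ⟨A, rfl⟩
    rw [realization_apply]
    have hP := preservesFormK_cayley_iff.2 A.2.1
    have ht : (cayley n * A.1 * cayleyInv n).trace = 0 := by
      rw [Matrix.trace_mul_comm, ← mul_assoc, cayleyInv_mul_cayley, one_mul]
      exact A.2.2
    generalize cayley n * A.1 * cayleyInv n = M at hP ht
    obtain ⟨a, b, c, d, rfl⟩ : ∃ a b c d, M = Matrix.fromBlocks a b c d :=
      ⟨_, _, _, _, (Matrix.fromBlocks_toBlocks M).symm⟩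
    obtain ⟨hb, hc, rfl⟩ := preservesFormK_iff.1 hP
    have hdec : Matrix.fromBlocks a b c (-aᴴ) = genS a + genX b + genY (-c) := by
      simp [genS_apply, genX, genY, Matrix.fromBlocks_add]
    have ha : a.trace.im = 0 := by
      rw [trace_fromBlocks, Matrix.trace_neg, Matrix.trace_conjTranspose, ← sub_eq_add_neg,
        sub_eq_zero] at ht
      exact Complex.conj_eq_iff_im.1 ht.symm
    rw [hdec, map_add, map_add]
    refine add_mem (add_mem ?_ ?_) ?_
    · have := Submodule.mem_map_of_mem (f := (obs μ).comp genS) (mem_span_hermitian_mul ha)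
      rw [Submodule.map_span] at this
      refine Submodule.span_le.2 ?_ this
      rintro _ ⟨_, ⟨u, v, hu, hv, rfl⟩, rfl⟩
      have h2 : ((obs μ).comp genS) (u * v) = (2 : ℝ) • fS μ u v := by
        rw [fS_eq_obs μ hu hv, ← map_smul, ← map_smul, smul_smul]
        norm_num
      rw [h2]
      exact Submodule.smul_mem _ _ (Submodule.subset_span ⟨u, v, hu, hv, Or.inr (Or.inr rfl)⟩)
    · rw [← fX_eq_obs]
      exact Submodule.subset_span ⟨b, b, hb, hb, Or.inl rfl⟩
    · rw [← fY_eq_obs μ]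
      have hc' : (-c).IsHermitian := Matrix.IsHermitian.neg hc
      exact Submodule.subset_span ⟨-c, -c, hc', hc', Or.inr (Or.inl rfl)⟩
  · rw [Submodule.span_le]
    have key : ∀ M : Mat2 n, PreservesFormK M → M.trace = 0 →
        obs μ M ∈ LinearMap.range (realization (n := n) μ) := by
      intro M hM ht
      obtain ⟨A, hA⟩ := exists_mem_su hM ht
      exact ⟨A, by rw [realization_apply, hA]⟩
    rintro _ ⟨u, v, hu, hv, rfl | rfl | rfl⟩
    · rw [fX_eq_obs]
      exact key _ (preservesFormK_genX hu) (by simp [genX, trace_fromBlocks])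
    · rw [fY_eq_obs μ]
      exact key _ (preservesFormK_genY hu) (by simp [genY, trace_fromBlocks])
    · rw [fS_eq_obs μ hu hv]
      refine key _ (preservesFormK_genS _) ?_
      rw [trace_genS, sub_eq_zero, Matrix.trace_smul, star_smul, ← Matrix.trace_conjTranspose,
        Matrix.conjTranspose_mul, hu.eq, hv.eq, Matrix.trace_mul_comm]
      simp

/-! ### Derivation rules -/

theorem diff_eq_of_hasFDerivWithinAt {f : PhaseSpace n → ℝ} {F : Mat n × Mat n → ℝ}
    {F' : (Mat n × Mat n) →L[ℝ] ℝ} {Q : PhaseSpace n} (hf : ∀ Q, f Q = F Q)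
    (hF : HasFDerivWithinAt F F' (tangentBundle n) Q) {ξ : Mat n × Mat n}
    (hξ : ξ ∈ phaseTangent Q) : diff f Q ξ = F' ξ := by
  have h1 : HasFDerivWithinAt (ext f) F' (tangentBundle n) Q :=
    hF.congr (fun y hy => (ext_apply f ⟨y, hy⟩).trans (hf _)) ((ext_apply f Q).trans (hf _))
  exact eqOn_tangentAt h1.differentiableWithinAt.hasFDerivWithinAt h1 hξ

theorem IsSmooth.hasFDerivWithinAt {f : PhaseSpace n → ℝ} (hf : IsSmooth f) (Q : PhaseSpace n) :
    HasFDerivWithinAt (ext f) (diff f Q) (tangentBundle n) Q :=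
  ((hf.differentiableOn (by simp)) Q Q.2).hasFDerivWithinAt

theorem isSmooth_of_contDiffOn {f : PhaseSpace n → ℝ} {F : Mat n × Mat n → ℝ}
    (hf : ∀ Q, f Q = F Q) (hF : ContDiffOn ℝ ∞ F (tangentBundle n)) : IsSmooth f :=
  ContDiffOn.congr hF fun y hy => (ext_apply f ⟨y, hy⟩).trans (hf _)

section Calculus

variable {f g h : PhaseSpace n → ℝ}

theorem IsSmooth.sub (hf : IsSmooth f) (hg : IsSmooth g) : IsSmooth (f - g) :=
  isSmooth_of_contDiffOn (F := fun Q => ext f Q - ext g Q) (fun Q => by simp [ext_apply])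
    (ContDiffOn.sub hf hg)

theorem IsSmooth.mul (hf : IsSmooth f) (hg : IsSmooth g) : IsSmooth (f * g) :=
  isSmooth_of_contDiffOn (F := fun Q => ext f Q * ext g Q) (fun Q => by simp [ext_apply])
    (ContDiffOn.mul hf hg)

theorem IsSmooth.const_smul (c : ℝ) (hf : IsSmooth f) : IsSmooth (c • f) :=
  isSmooth_of_contDiffOn (F := fun Q => c * ext f Q) (fun Q => by simp [ext_apply])
    (contDiffOn_const.mul hf)

theorem isSmooth_one : IsSmooth (1 : PhaseSpace n → ℝ) :=
  isSmooth_of_contDiffOn (F := fun _ => 1) (fun _ => rfl) contDiffOn_const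

theorem IsSmooth.div (hf : IsSmooth f) (hg : IsSmooth g) (h0 : ∀ Q, g Q ≠ 0) :
    IsSmooth (f / g) :=
  isSmooth_of_contDiffOn (F := fun Q => ext f Q / ext g Q) (fun Q => by simp [ext_apply])
    (ContDiffOn.div hf hg fun Q hQ => (ext_apply g ⟨Q, hQ⟩).trans_ne (h0 _))

theorem poisson_mul (μ : ℝ) (hf : IsSmooth f) (hg : IsSmooth g) (h : PhaseSpace n → ℝ)
    (Q : PhaseSpace n) :
    poisson μ (f * g) h Q = f Q * poisson μ g h Q + g Q * poisson μ f h Q := by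
  have := diff_eq_of_hasFDerivWithinAt (f := f * g) (F := fun Q => ext f Q * ext g Q)
    (fun Q => by simp [ext_apply]) ((hf.hasFDerivWithinAt Q).mul (hg.hasFDerivWithinAt Q))
    (isHamiltonianVector_hamiltonianVector μ h Q).1
  simpa [ext_apply, poisson] using this

theorem poisson_sub (μ : ℝ) (hf : IsSmooth f) (hg : IsSmooth g) (h : PhaseSpace n → ℝ)
    (Q : PhaseSpace n) : poisson μ (f - g) h Q = poisson μ f h Q - poisson μ g h Q := by
  have := diff_eq_of_hasFDerivWithinAt (f := f - g) (F := fun Q => ext f Q - ext g Q)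
    (fun Q => by simp [ext_apply]) ((hf.hasFDerivWithinAt Q).sub (hg.hasFDerivWithinAt Q))
    (isHamiltonianVector_hamiltonianVector μ h Q).1
  simpa [poisson] using this

theorem poisson_smul (μ c : ℝ) (hf : IsSmooth f) (h : PhaseSpace n → ℝ)
    (Q : PhaseSpace n) : poisson μ (c • f) h Q = c * poisson μ f h Q := by
  have := diff_eq_of_hasFDerivWithinAt (f := c • f) (F := fun Q => c * ext f Q)
    (fun Q => by simp [ext_apply]) ((hf.hasFDerivWithinAt Q).const_mul c)
    (isHamiltonianVector_hamiltonianVector μ h Q).1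
  simpa [poisson] using this

theorem poisson_one (μ : ℝ) (h : PhaseSpace n → ℝ) (Q : PhaseSpace n) :
    poisson μ 1 h Q = 0 :=
  diff_eq_of_hasFDerivWithinAt (f := 1) (F := fun _ => 1) (fun _ => rfl)
    (hasFDerivWithinAt_const (1 : ℝ) _ _) (isHamiltonianVector_hamiltonianVector μ h Q).1

theorem twistedForm_swap (μ : ℝ) (Q ξ η : Mat n × Mat n) :
    twistedForm μ Q ξ η = -twistedForm μ Q η ξ := by
  have h : keplerForm Q.1 ξ.1 η.1 = -keplerForm Q.1 η.1 ξ.1 := by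
    rw [keplerForm, keplerForm, ← lie_skew, mul_neg, Matrix.trace_neg, mul_neg, neg_div,
      Complex.neg_re]
  rw [twistedForm_apply, twistedForm_apply, h]
  ring

/-- Both brackets are values of the skew form on the two Hamiltonian vectors. -/
theorem poisson_swap (μ : ℝ) (f g : PhaseSpace n → ℝ) (Q : PhaseSpace n) :
    poisson μ f g Q = -poisson μ g f Q := by
  have hf := isHamiltonianVector_hamiltonianVector μ f Q
  have hg := isHamiltonianVector_hamiltonianVector μ g Q
  have h1 := hf.2 _ hg.1
  have h2 := hg.2 _ hf.1
  rw [twistedForm_swap] at h1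
  unfold poisson
  linarith

end Calculus

/-! ### The Kepler problem -/

theorem fY_one_ne_zero (Q : PhaseSpace n) : fY 1 Q ≠ 0 := by
  have hn : (n : ℝ) ≠ 0 := Nat.cast_ne_zero.2 (ne_zero_of_mem_tangentBundle Q.2)
  rw [fY, ip_eq_trace, one_mul]
  exact mul_ne_zero (one_div_ne_zero hn) (rtr_ne_zero Q)

theorem hamiltonian_eq (μ : ℝ) : hamiltonian (n := n) μ
    = (1 / 2 : ℝ) • (fX μ 1 / fY 1) - 1 / fY 1 := by
  ext Q
  have hn : (n : ℝ) ≠ 0 := Nat.cast_ne_zero.2 (ne_zero_of_mem_tangentBundle Q.2)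
  have ht := rtr_ne_zero Q
  have h1 : ip 1 Q.1.1 = 1 / n * rtr Q.1.1 := by rw [ip_eq_trace, one_mul, rtr]
  have h2 : str Q.1.2 1 Q.1.2 = jordan Q.1.2 Q.1.2 := by
    rw [str_eq, jordan, mul_one]
  have h3 : jordan Q.1.1 1 = Q.1.1 := by
    rw [jordan, mul_one, one_mul, ← two_smul ℝ, smul_smul]
    norm_num
  have h4 : ⁅(1 : Mat n), Q.1.2⁆ = 0 := by rw [Ring.lie_def, one_mul, mul_one, sub_self]
  simp only [hamiltonian, fX, fY, h1, h2, h3, h4, Pi.sub_apply, Pi.smul_apply, Pi.div_apply,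
    Pi.one_apply, mul_zero, Matrix.trace_zero, Complex.zero_re, zero_div, sub_zero, smul_eq_mul]
  field_simp

theorem lrl_eq (μ : ℝ) (u : Mat n) :
    lrl μ u = (1 / 2 : ℝ) • fX μ u - fY u * hamiltonian μ := by
  ext Q
  simp only [lrl, hamiltonian_eq, Pi.sub_apply, Pi.smul_apply, Pi.div_apply, Pi.add_apply,
    Pi.mul_apply, Pi.one_apply, smul_eq_mul]
  ring

theorem isSmooth_fX (μ : ℝ) (u : Mat n) : IsSmooth (fX μ u) := by
  rw [fX_eq_obs]
  exact isSmooth_obs μ _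

theorem isSmooth_fY (v : Mat n) : IsSmooth (fY v) := by
  rw [fY_eq_obs 0]
  exact isSmooth_obs 0 _

theorem isSmooth_fS (μ : ℝ) {u v : Mat n} (hu : u.IsHermitian) (hv : v.IsHermitian) :
    IsSmooth (fS μ u v) := by
  rw [fS_eq_obs μ hu hv]
  exact isSmooth_obs μ _

theorem isSmooth_hamiltonian (μ : ℝ) : IsSmooth (hamiltonian (n := n) μ) := by
  rw [hamiltonian_eq]
  exact (((isSmooth_fX μ 1).div (isSmooth_fY 1) fY_one_ne_zero).const_smul _).sub
    (isSmooth_one.div (isSmooth_fY 1) fY_one_ne_zero)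

theorem isSmooth_lrl (μ : ℝ) (u : Mat n) : IsSmooth (lrl μ u) := by
  rw [lrl_eq]
  exact ((isSmooth_fX μ u).const_smul _).sub ((isSmooth_fY u).mul (isSmooth_hamiltonian μ))

/-- Both `str` operators reduce to Jordan multiplication by u, and the commutator with the identity
vanishes. -/
theorem fS_one_comm (μ : ℝ) (u : Mat n) : fS μ u 1 = fS μ 1 u := by
  ext Q
  simp [fS, str_eq, Ring.lie_def]

theorem poisson_lrl_hamiltonian (μ : ℝ) {u : Mat n} (hu : u.IsHermitian) :
    poisson μ (lrl μ u) (hamiltonian μ) = 0 := by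
  ext Q
  have h1 : (1 : Mat n).IsHermitian := Matrix.isHermitian_one
  obtain ⟨hXX, -, hXY, -⟩ := poisson_relations μ h1 hu h1 h1
  obtain ⟨-, hYY, hXY', -⟩ := poisson_relations μ hu h1 h1 h1
  have hYY' := (poisson_relations μ h1 hu h1 h1).2.1
  have hX := isSmooth_fX (n := n) μ
  have hY := isSmooth_fY (n := n)
  have hH := isSmooth_hamiltonian (n := n) μ
  have hprod : hamiltonian (n := n) μ * fY 1 = (1 / 2 : ℝ) • fX μ 1 - 1 := by
    ext Q
    have := fY_one_ne_zero Q
    simp only [hamiltonian_eq, Pi.sub_apply, Pi.smul_apply, Pi.div_apply, Pi.mul_apply,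
      Pi.one_apply, smul_eq_mul]
    field_simp
  -- Leibniz applied to H Y_e = X_e / 2 - 1 avoids differentiating a quotient. It yields Y_e {H,
  -- X_u} = -2 H S_{eu} and Y_e {H, Y_u} = -S_{eu}, whose contributions to Y_e {A_u, H} cancel.
  have key : ∀ f : PhaseSpace n → ℝ,
      hamiltonian μ Q * poisson μ (fY 1) f Q + fY 1 Q * poisson μ (hamiltonian μ) f Q
        = 1 / 2 * poisson μ (fX μ 1) f Q := by
    intro f
    rw [← poisson_mul μ hH (hY 1), hprod, poisson_sub μ ((hX 1).const_smul _) isSmooth_one,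
      poisson_smul μ _ (hX 1), poisson_one, sub_zero]
  have kX := key (fX μ u)
  have kY := key (fY u)
  rw [hXX, poisson_swap, hXY', fS_one_comm] at kX
  rw [hXY, hYY'] at kY
  have hHH : poisson μ (hamiltonian μ) (hamiltonian μ) Q = 0 := by
    have := poisson_swap μ (hamiltonian μ) (hamiltonian μ) Q
    linarith
  rw [lrl_eq, poisson_sub μ ((hX u).const_smul _) ((hY u).mul hH), poisson_smul μ _ (hX u),
    poisson_mul μ (hY u) hH, hHH, poisson_swap μ (fX μ u), poisson_swap μ (fY u)]
  simp only [Pi.zero_apply, Pi.smul_apply, smul_eq_mul] at kX kY ⊢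
  refine (mul_eq_zero.1 ?_).resolve_left (fY_one_ne_zero Q)
  linear_combination (-1 / 2) * kX + hamiltonian μ Q * kY

end U1Kepler

end

theorem theorem4p2 (n : ℕ) (hn : 2 ≤ n) (μ : ℝ) :
    -- `ω_μ` is nondegenerate on `T C_1`: Hamiltonian vector fields exist and are unique
    (∀ g : U1Kepler.PhaseSpace n → ℝ, U1Kepler.IsSmooth g → ∀ Q : U1Kepler.PhaseSpace n,
      ∃! ξ, U1Kepler.IsHamiltonianVector μ g Q ξ) ∧
    -- smoothness
    (∀ u v : U1Kepler.Mat n, u.IsHermitian → v.IsHermitian →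
      U1Kepler.IsSmooth (U1Kepler.fX μ u) ∧
      U1Kepler.IsSmooth (U1Kepler.fY u) ∧
      U1Kepler.IsSmooth (U1Kepler.fS μ u v)) ∧
    -- the commutation relations of the conformal algebra
    (∀ u v z w : U1Kepler.Mat n,
      u.IsHermitian → v.IsHermitian → z.IsHermitian → w.IsHermitian →
      U1Kepler.poisson μ (U1Kepler.fX μ u) (U1Kepler.fX μ v) = 0 ∧
      U1Kepler.poisson μ (U1Kepler.fY u) (U1Kepler.fY v) = 0 ∧
      U1Kepler.poisson μ (U1Kepler.fX μ u) (U1Kepler.fY v) = (-2 : ℝ) • U1Kepler.fS μ u v ∧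
      U1Kepler.poisson μ (U1Kepler.fS μ u v) (U1Kepler.fX μ z)
        = U1Kepler.fX μ (U1Kepler.str u v z) ∧
      U1Kepler.poisson μ (U1Kepler.fS μ u v) (U1Kepler.fY z)
        = -U1Kepler.fY (U1Kepler.str v u z) ∧
      U1Kepler.poisson μ (U1Kepler.fS μ u v) (U1Kepler.fS μ z w)
        = U1Kepler.fS μ (U1Kepler.str u v z) w - U1Kepler.fS μ z (U1Kepler.str v u w)) ∧
    -- the Poisson realization of `su(n, n)`
    (∃ Φ : U1Kepler.su n →ₗ[ℝ] (U1Kepler.PhaseSpace n → ℝ),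
      (∀ A, U1Kepler.IsSmooth (Φ A)) ∧
      (∀ A B, Φ ⁅A, B⁆ = U1Kepler.poisson μ (Φ A) (Φ B)) ∧
      LinearMap.range Φ = Submodule.span ℝ
        {f | ∃ u v : U1Kepler.Mat n, u.IsHermitian ∧ v.IsHermitian ∧
          (f = U1Kepler.fX μ u ∨ f = U1Kepler.fY u ∨ f = U1Kepler.fS μ u v)}) ∧
    -- the Hamiltonian and the conserved Laplace–Runge–Lenz vector
    (U1Kepler.IsSmooth (U1Kepler.hamiltonian (n := n) μ) ∧
      U1Kepler.hamiltonian (n := n) μ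
        = (1 / 2 : ℝ) • (U1Kepler.fX μ 1 / U1Kepler.fY 1) - 1 / U1Kepler.fY 1 ∧
      ∀ u : U1Kepler.Mat n, u.IsHermitian →
        U1Kepler.IsSmooth (U1Kepler.lrl μ u) ∧
        U1Kepler.poisson μ (U1Kepler.lrl μ u) (U1Kepler.hamiltonian μ) = 0) := by
  refine ⟨fun g _ Q => U1Kepler.existsUnique_isHamiltonianVector μ g Q,
    fun u v hu hv => ⟨U1Kepler.isSmooth_fX μ u, U1Kepler.isSmooth_fY u,
      U1Kepler.isSmooth_fS μ hu hv⟩,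
    fun u v z w hu hv hz hw => U1Kepler.poisson_relations μ hu hv hz hw,
    ⟨U1Kepler.realization μ, fun A => U1Kepler.isSmooth_obs μ _, U1Kepler.realization_lie μ,
      U1Kepler.range_realization μ⟩,
    U1Kepler.isSmooth_hamiltonian μ, U1Kepler.hamiltonian_eq μ,
    fun u hu => ⟨U1Kepler.isSmooth_lrl μ u, U1Kepler.poisson_lrl_hamiltonian μ hu⟩⟩
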